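/- **Theorem.** Let $T>0$, let $\mathbb{T}^3=\mathbb{R}^3/\mathbb{Z}^3$, and let $(u,h)$ be a weak solution on $[0,T]$ of the incompressible inviscid Hall-MHD equations $$u_t+u\cdot\nabla u-h\cdot\nabla h+\nabla\Pi=0,\qquad h_t+u\cdot\nabla h-h\cdot\nabla u+\nabla\times\big[(\nabla\times h)\times h\big]=0,\qquad \operatorname{div}u=\operatorname{div}h=0,$$ that is: $u,h\in C_{\rm weak}([0,T];L^2(\mathbb{T}^3;\mathbb{R}^3))$; $u(t)$ and $h(t)$ are divergence-free in the sense of distributions for every $t\in[0,T]$; and for every divergence-free $\varphi\in C_c^\infty((0,T)\times\mathbb{T}^3;\mathbb{R}^3)$ $$\int_0^T\!\!\int_{\mathbb{T}^3}\partial_t\varphi\cdot u+\nabla\varphi:(u\otimes u-h\otimes h)\,dx\,dt=0,$$ $$\int_0^T\!\!\int_{\mathbb{T}^3}\partial_t\varphi\cdot h+\nabla\varphi:(h\otimes u-u\otimes h)+\nabla(\nabla\times\varphi):(h\otimes h)\,dx\,dt=0,$$ where $\nabla\varphi:(a\otimes b)=\sum_{i,j}\partial_i\varphi_j\,a_j\,b_i$.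 Assume that $h\in C([0,T];L^3(\mathbb{T}^3))$, that $\int_{\mathbb{T}^3}h(0,x)\,dx=0$, that $u\in L^3(0,T;L^3(\mathbb{T}^3))$, and that $h\in L^3(0,T;\underline{B}^{1/3}_{3,VMO}(\mathbb{T}^3))$, i.e. $h\in L^3(0,T;L^3(\mathbb{T}^3))$ and $$\lim_{\varepsilon\to0^+}\frac1{\varepsilon^{1/3}}\left(\int_0^T\int_{\mathbb{T}^3}\frac{1}{|B_\varepsilon(0)|}\int_{B_\varepsilon(0)}|h(t,x)-h(t,x-y)|^3\,dy\,dx\,dt\right)^{1/3}=0 .$$ Then for every $t\in[0,T]$ the vector potential $H(t)=\operatorname{curl}^{-1}h(t)$ exists, where $\operatorname{curl}^{-1}h(t)$ is the (a.e. unique) divergence-free, mean-zero field in $L^2(\mathbb{T}^3;\mathbb{R}^3)$ whose curl, in the sense of distributions, is $h(t)$; the function $H(t)\cdot\operatorname{curl}H(t)=H(t)\cdot h(t)$ is integrable; and the magnetic helicity is conserved: for every $t\in[0,T]$ $$\int_{\mathbb{T}^3}H(t)\cdot\operatorname{curl}H(t)\,dx=\int_{\mathbb{T}^3}H(0)\cdot\operatorname{curl}H(0)\,dx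 .$$ -/

import Mathlib

open MeasureTheory Set Filter Topology
open scoped ContDiff ENNReal

noncomputable section

namespace HallMHD

/-- The flat torus `𝕋³ = ℝ³/ℤ³`, with its normalised volume measure. -/
abbrev Torus : Type := UnitAddTorus (Fin 3)

/-- Vectors in `ℝ³`, with the Euclidean norm and inner product. -/
abbrev Vec : Type := EuclideanSpace ℝ (Fin 3)

/-- The covering map `ℝ³ → 𝕋³`. -/
def toTorus (y : Vec) : Torus := fun i => (y i : UnitAddCircle)

/-! ### Smooth functions on the torus and their derivatives -/

section Calculus

variable {F : Type*} [NormedAddCommGroup F] [NormedSpace ℝ F]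

/-- `f : 𝕋³ → F` is `C^∞`: its periodic lift to `ℝ³` is `C^∞`. -/
def IsSmooth (f : Torus → F) : Prop :=
  ContDiff ℝ ∞ (fun y : Vec => f (toTorus y))

/-- The partial derivative `∂ᵢ f` at the point `x` of the torus. -/
def pderiv (i : Fin 3) (f : Torus → F) (x : Torus) : F :=
  deriv (fun s : ℝ => f (x + Pi.single i (s : UnitAddCircle))) 0

end Calculus

/-- The divergence of a (smooth) vector field. -/
def div (v : Torus → Vec) (x : Torus) : ℝ := ∑ i, pderiv i v x i

/-- The curl of a (smooth) vector field. -/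
def curl (v : Torus → Vec) (x : Torus) : Vec :=
  !₂[pderiv 1 v x 2 - pderiv 2 v x 1,
     pderiv 2 v x 0 - pderiv 0 v x 2,
     pderiv 0 v x 1 - pderiv 1 v x 0]

/-- The contraction `∇v : (a ⊗ b) = ∑ᵢⱼ (∂ᵢ vⱼ) aⱼ bᵢ = a · (b · ∇) v` at the point `x`. -/
def gradContract (v : Torus → Vec) (a b : Vec) (x : Torus) : ℝ :=
  ∑ i, ∑ j, pderiv i v x j * a j * b i

/-! ### Distributional divergence and curl on the torus -/

/-- `div v = 0` in the sense of distributions on `𝕋³`. -/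
def IsDivFree (v : Torus → Vec) : Prop :=
  ∀ ψ : Torus → ℝ, IsSmooth ψ → ∫ x, ∑ i, v x i * pderiv i ψ x = 0

/-- `curl V = w` in the sense of distributions on `𝕋³`. -/
def HasWeakCurl (V w : Torus → Vec) : Prop :=
  ∀ φ : Torus → Vec, IsSmooth φ →
    ∫ x, inner ℝ (V x) (curl φ x) = ∫ x, inner ℝ (w x) (φ x)

/-- `V = curl⁻¹ w`: the field `V ∈ L²(𝕋³)` is the vector potential of `w`, that is, the
(almost everywhere unique) divergence-free field of mean zero whose curl is `w`. -/
structure IsCurlInv (w V : Torus → Vec) : Prop where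
  memLp : MemLp V 2 volume
  mean_zero : ∫ x, V x = 0
  divFree : IsDivFree V
  curl_eq : HasWeakCurl V w

/-! ### Function spaces on `[0,T] × 𝕋³` -/

/-- `f ∈ C([0,T]; L^p(𝕋³))`. -/
def ContinuousInLp (T : ℝ) (p : ℝ≥0∞) (f : ℝ → Torus → Vec) : Prop :=
  (∀ t ∈ Icc 0 T, MemLp (f t) p volume) ∧
  ∀ t₀ ∈ Icc 0 T,
    Tendsto (fun t => eLpNorm (fun x => f t x - f t₀ x) p volume) (𝓝[Icc 0 T] t₀) (𝓝 0)

/-- `f ∈ C_weak([0,T]; L²(𝕋³))`. -/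
def WeaklyContinuousInL2 (T : ℝ) (f : ℝ → Torus → Vec) : Prop :=
  (∀ t ∈ Icc 0 T, MemLp (f t) 2 volume) ∧
  ∀ g : Torus → Vec, MemLp g 2 volume →
    ContinuousOn (fun t => ∫ x, inner ℝ (f t x) (g x)) (Icc 0 T)

/-- `f ∈ L^p(0,T; L^q(𝕋³))`, for finite exponents `p, q ≥ 1`. -/
def MemLpLq (T p q : ℝ) (f : ℝ → Torus → Vec) : Prop :=
  AEStronglyMeasurable (Function.uncurry f) ((volume.restrict (Ioo 0 T)).prod volume) ∧
  ∫⁻ t in Ioo 0 T, (∫⁻ x, ‖f t x‖ₑ ^ q) ^ (p / q) < ⊤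

/-- The Besov-VMO space `L^p(0,T; B^α_{q,VMO}(𝕋³))`, for finite exponents `p, q ≥ 1`:
`f ∈ L^p(0,T; L^q)`, and
`ε^{-α} (∫₀ᵀ (∫_{𝕋³} ⨍_{|y| < ε} |f(t,x) - f(t,x-y)|^q dy dx)^{p/q} dt)^{1/p}` tends to `0`
as `ε` tends to `0` from the right. -/
def MemBesovVMO (T p α q : ℝ) (f : ℝ → Torus → Vec) : Prop :=
  MemLpLq T p q f ∧
  Tendsto
    (fun ε : ℝ => ENNReal.ofReal (ε ^ (-α)) *
      (∫⁻ t in Ioo 0 T,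
        (∫⁻ x, ⨍⁻ y, ‖f t x - f t (x - toTorus y)‖ₑ ^ q
          ∂(volume.restrict (Metric.ball (0 : Vec) ε))) ^ (p / q)) ^ (1 / p))
    (𝓝[>] 0) (𝓝 0)

/-! ### Weak solutions of the inviscid Hall-MHD equations -/

/-- Divergence-free test vector fields `φ ∈ C_c^∞((0,T) × 𝕋³; ℝ³)`. -/
structure IsSolenoidalTestField (T : ℝ) (φ : ℝ → Torus → Vec) : Prop where
  smooth : ContDiff ℝ ∞ (fun p : ℝ × Vec => φ p.1 (toTorus p.2))
  compactSupport : ∃ a b : ℝ, 0 < a ∧ b < T ∧ ∀ t ∉ Icc a b, φ t = 0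
  divFree : ∀ t x, div (φ t) x = 0

/-- `(u, h)` is a weak solution on `[0,T]` of the incompressible inviscid Hall-MHD equations
`u_t + u·∇u - h·∇h + ∇Π = 0`, `h_t + u·∇h - h·∇u + ∇×((∇×h)×h) = 0`, `div u = div h = 0`,
where `∇×((∇×h)×h) = ∇×(div (h ⊗ h))`. -/
structure IsWeakSolution (T : ℝ) (u h : ℝ → Torus → Vec) : Prop where
  weakCont_u : WeaklyContinuousInL2 T u
  weakCont_h : WeaklyContinuousInL2 T h
  divFree_u : ∀ t ∈ Icc 0 T, IsDivFree (u t)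
  divFree_h : ∀ t ∈ Icc 0 T, IsDivFree (h t)
  momentum : ∀ φ, IsSolenoidalTestField T φ →
    ∫ t in Ioo 0 T, ∫ x,
      (inner ℝ (deriv (fun s => φ s x) t) (u t x)
        + (gradContract (φ t) (u t x) (u t x) x
          - gradContract (φ t) (h t x) (h t x) x)) = 0
  induction : ∀ φ, IsSolenoidalTestField T φ →
    ∫ t in Ioo 0 T, ∫ x,
      (inner ℝ (deriv (fun s => φ s x) t) (h t x)
        + (gradContract (φ t) (h t x) (u t x) x
          - gradContract (φ t) (u t x) (h t x) x)
        + gradContract (curl (φ t)) (h t x) (h t x) x) = 0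

end HallMHD

end

noncomputable section

namespace HallMHD

/-! ### The flat torus and its covering map -/

/-! Helicity is the quadratic form of `curl⁻¹`, which is self-adjoint, so its mollification `∫ h ·
(K ∗ H)` by an even kernel `K` at scale `ε` is again a symmetric form. Hence the increment of the
mollified helicity between two times `s ≤ t` is `h(t) - h(s)` paired with `ψ = K ∗ (H(t) + H(s))`.
This `ψ` is smooth, divergence-free and independent of time, so the induction equation applies to it
after a Du Bois-Reymond argument, and no time regularity of `H` is needed (`mollHelicity_sub`). Only
`curl ψ = K ∗ (h(t) + h(s))` enters the resulting flux.

On a short interval the uniform continuity of `h` in `L³` allows `h(t) + h(s)` to be replaced by `2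
h(τ)`. For a fixed kernel these errors vanish as the partition is refined. What remains is the time
integral of the flux of `K ∗ h(τ)` against `(u(τ), h(τ))` (`enorm_mollHelicity_sub_le`), which has
two parts.

The ideal part is `(K ∗ h) · (u × h)`. Since `h · (u × h) = 0`, it equals `(K ∗ h - h) · (u × h)`
and is controlled by increments of `h`. The Hall part `h · (h · ∇)(K ∗ h)` is cubic in `h`. Oddness
of `∇K` and `div h = 0` turn its integral into `-1/4 ∫∫ ∇K(y) · δh |δh|²`, where `δh = h(x) - h(x -
y)` (`integral_gradContract_moll`). The gradient costs `ε⁻¹`, and the Besov-VMO condition says that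
`ε⁻¹` times the mean cubic increment tends to zero. With Young's inequality for the ideal part, the
whole flux tends to zero (`enorm_integral_flux_moll_self_le`, `helicity_conserved`). The mollified
helicity tends to the helicity at each fixed time, by continuity of translations in `L²`.

Testing the induction equation with constant fields shows that the mean of `h` is conserved, hence
zero. The potential is then built from its Fourier coefficients `(i / 2π) n × ĥ(n) / |n|²`
(`exists_isCurlInv`). -/

theorem volume_unitAddCircle :
    (volume : Measure UnitAddCircle) = AddCircle.haarAddCircle := by
  simp [AddCircle.volume_eq_smul_haarAddCircle]

theorem toTorus_add (y z : Vec) : toTorus (y + z) = toTorus y + toTorus z := by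
  ext i; simp [toTorus]

theorem toTorus_sub (y z : Vec) : toTorus (y - z) = toTorus y - toTorus z := by
  ext i; simp [toTorus]

theorem toTorus_neg (y : Vec) : toTorus (-y) = -toTorus y := by
  ext i; simp [toTorus]

theorem toTorus_zero : toTorus 0 = 0 := by
  ext i; simp [toTorus]

theorem isOpenQuotientMap_toTorus : IsOpenQuotientMap toTorus := by
  have h : IsOpenQuotientMap (Pi.map fun (_ : Fin 3) (s : ℝ) => (s : UnitAddCircle)) :=
    IsOpenQuotientMap.piMap fun _ => QuotientAddGroup.isOpenQuotientMap_mk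
  exact h.comp (EuclideanSpace.equiv (Fin 3) ℝ).toHomeomorph.isOpenQuotientMap

@[fun_prop]
theorem continuous_toTorus : Continuous toTorus := isOpenQuotientMap_toTorus.continuous

theorem surjective_toTorus : Function.Surjective toTorus := isOpenQuotientMap_toTorus.surjective

@[fun_prop]
theorem measurable_toTorus : Measurable toTorus := continuous_toTorus.measurable

/-- The `i`-th vector of the standard basis of `ℝ³`. -/
abbrev basisVec (i : Fin 3) : Vec := EuclideanSpace.single i 1

theorem toTorus_smul_basisVec (s : ℝ) (i : Fin 3) :
    toTorus (s • basisVec i) = Pi.single i (s : UnitAddCircle) := by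
  ext j
  by_cases hj : j = i
  · subst hj; simp [toTorus]
  · simp [toTorus, hj]

/-! ### Calculus of smooth functions on the torus through their periodic lifts -/

section Smooth

variable {F : Type*} [NormedAddCommGroup F] [NormedSpace ℝ F]
variable {E : Type*} [NormedAddCommGroup E] [NormedSpace ℝ E]

theorem IsSmooth.continuous {f : Torus → F} (hf : IsSmooth f) : Continuous f :=
  isOpenQuotientMap_toTorus.isQuotientMap.continuous_iff.2 (ContDiff.continuous hf)

theorem pderiv_toTorus {f : Torus → F} {y : Vec}
    (hf : DifferentiableAt ℝ (fun y : Vec => f (toTorus y)) y) (i : Fin 3) :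
    pderiv i f (toTorus y) = fderiv ℝ (fun y : Vec => f (toTorus y)) y (basisVec i) := by
  have h1 : HasDerivAt (fun s : ℝ => y + s • basisVec i) (basisVec i) 0 := by
    simpa using ((hasDerivAt_id (0 : ℝ)).smul_const (basisVec i)).const_add y
  have h2 := HasFDerivAt.comp_hasDerivAt (f := fun s : ℝ => y + s • basisVec i) (0 : ℝ)
    (l := fun y : Vec => f (toTorus y)) (by simpa using hf.hasFDerivAt) h1
  have h3 := h2.deriv
  simpa [Function.comp_def, toTorus_add, toTorus_smul_basisVec, pderiv] using h3

theorem IsSmooth.pderiv_toTorus {f : Torus → F} (hf : IsSmooth f) (i : Fin 3) (y : Vec) :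
    pderiv i f (toTorus y) = fderiv ℝ (fun y : Vec => f (toTorus y)) y (basisVec i) :=
  HallMHD.pderiv_toTorus ((ContDiff.differentiable hf (by simp)) y) i

theorem IsSmooth.pderiv {f : Torus → F} (hf : IsSmooth f) (i : Fin 3) :
    IsSmooth (HallMHD.pderiv i f) := by
  unfold IsSmooth
  simp_rw [hf.pderiv_toTorus]
  exact (ContDiff.fderiv_right hf (by simp)).clm_apply contDiff_const

theorem IsSmooth.comp_clm {f : Torus → F} (hf : IsSmooth f) (A : F →L[ℝ] E) :
    IsSmooth (fun x => A (f x)) := A.contDiff.comp hf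

theorem IsSmooth.hasDerivAt {f : Torus → F} (hf : IsSmooth f) (i : Fin 3) (x : Torus) (s : ℝ) :
    HasDerivAt (fun s : ℝ => f (x + Pi.single i (s : UnitAddCircle)))
      (HallMHD.pderiv i f (x + Pi.single i (s : UnitAddCircle))) s := by
  obtain ⟨y, rfl⟩ := surjective_toTorus x
  rw [← toTorus_smul_basisVec, ← toTorus_add, hf.pderiv_toTorus]
  have h1 : HasDerivAt (fun s : ℝ => y + s • basisVec i) (basisVec i) s := by
    simpa using ((hasDerivAt_id s).smul_const (basisVec i)).const_add y
  have h2 := HasFDerivAt.comp_hasDerivAt (f := fun s : ℝ => y + s • basisVec i) s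
    (l := fun y : Vec => f (toTorus y))
    ((ContDiff.differentiable hf (by simp)) (y + s • basisVec i)).hasFDerivAt h1
  simpa [Function.comp_def, toTorus_add, toTorus_smul_basisVec] using h2

theorem IsSmooth.hasDerivAt_zero {f : Torus → F} (hf : IsSmooth f) (i : Fin 3) (x : Torus) :
    HasDerivAt (fun s : ℝ => f (x + Pi.single i (s : UnitAddCircle)))
      (HallMHD.pderiv i f x) 0 := by
  simpa using hf.hasDerivAt i x 0

theorem IsSmooth.pderiv_comp_clm {f : Torus → F} (hf : IsSmooth f) (A : F →L[ℝ] E) (i : Fin 3)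
    (x : Torus) : HallMHD.pderiv i (fun x => A (f x)) x = A (HallMHD.pderiv i f x) :=
  (A.hasFDerivAt.comp_hasDerivAt 0 (hf.hasDerivAt_zero i x)).deriv

theorem IsSmooth.add {f g : Torus → F} (hf : IsSmooth f) (hg : IsSmooth g) :
    IsSmooth (fun x => f x + g x) := ContDiff.add hf hg

theorem IsSmooth.sub {f g : Torus → F} (hf : IsSmooth f) (hg : IsSmooth g) :
    IsSmooth (fun x => f x - g x) := ContDiff.sub hf hg

theorem isSmooth_const (c : F) : IsSmooth (fun _ : Torus => c) := contDiff_const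

theorem IsSmooth.sum {ι : Type*} {s : Finset ι} {f : ι → Torus → F}
    (hf : ∀ i ∈ s, IsSmooth (f i)) : IsSmooth (fun x => ∑ i ∈ s, f i x) :=
  ContDiff.sum hf

theorem IsSmooth.pderiv_add {f g : Torus → F} (hf : IsSmooth f) (hg : IsSmooth g) (i : Fin 3)
    (x : Torus) : HallMHD.pderiv i (fun x => f x + g x) x =
      HallMHD.pderiv i f x + HallMHD.pderiv i g x :=
  ((hf.hasDerivAt_zero i x).add (hg.hasDerivAt_zero i x)).deriv

theorem IsSmooth.pderiv_const_smul {f : Torus → F} (hf : IsSmooth f) (c : ℝ) (i : Fin 3)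
    (x : Torus) : HallMHD.pderiv i (fun x => c • f x) x = c • HallMHD.pderiv i f x :=
  ((hf.hasDerivAt_zero i x).const_smul c).deriv

theorem pderiv_const (c : F) (i : Fin 3) (x : Torus) : pderiv i (fun _ => c) x = 0 := by
  simp [pderiv]

theorem IsSmooth.exists_bound {f : Torus → F} (hf : IsSmooth f) : ∃ C, ∀ x, ‖f x‖ ≤ C := by
  obtain ⟨C, hC⟩ := isCompact_univ.exists_bound_of_continuousOn hf.continuous.continuousOn
  exact ⟨C, fun x => hC x (mem_univ x)⟩

theorem IsSmooth.memLp [SecondCountableTopologyEither Torus F] {f : Torus → F} (hf : IsSmooth f)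
    (p : ℝ≥0∞) : MemLp f p volume := by
  obtain ⟨C, hC⟩ := hf.exists_bound
  exact MemLp.of_bound hf.continuous.aestronglyMeasurable C (Eventually.of_forall hC)

/-- If `f` and its derivative along a curve of translations are continuous, the derivative
has mean zero. -/
theorem integral_deriv_translate {f f' : Torus → F} (hf : Continuous f) (hf' : Continuous f')
    (γ : ℝ → Torus) (h : ∀ x s, HasDerivAt (fun s => f (x + γ s)) (f' (x + γ s)) s) :
    ∫ x, f' x = 0 := by
  obtain ⟨C, hC⟩ := isCompact_univ.exists_bound_of_continuousOn hf'.continuousOn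
  have hs : ∀ s : ℝ, Continuous fun x : Torus => x + γ s :=
    fun s => continuous_id.add continuous_const
  have hi : Integrable (fun x : Torus => f (x + γ 0)) :=
    (hf.comp (hs 0)).integrable_of_hasCompactSupport (HasCompactSupport.of_compactSpace _)
  have hb : Integrable (fun _ : Torus => C) := integrable_const _
  have key := (hasDerivAt_integral_of_dominated_loc_of_deriv_le (x₀ := (0 : ℝ)) (s := univ)
    (F := fun (s : ℝ) (x : Torus) => f (x + γ s))
    (F' := fun (s : ℝ) (x : Torus) => f' (x + γ s))
    univ_mem (Eventually.of_forall fun s => (hf.comp (hs s)).aestronglyMeasurable) hi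
    (hf'.comp (hs 0)).aestronglyMeasurable (Eventually.of_forall fun x s _ => hC _ (mem_univ _)) hb
    (Eventually.of_forall fun x s _ => h x s)).2
  -- Translation invariance makes the differentiated integral constant in `s`.
  have h0 : (fun s : ℝ => ∫ x : Torus, f (x + γ s)) = fun _ => ∫ x, f x := by
    funext s; exact integral_add_right_eq_self f _
  rw [h0] at key
  have h1 := key.unique (hasDerivAt_const _ _)
  rwa [integral_add_right_eq_self f'] at h1

/-- Partial derivatives of smooth functions have mean zero. -/
theorem IsSmooth.integral_pderiv {f : Torus → F} (hf : IsSmooth f) (i : Fin 3) :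
    ∫ x, HallMHD.pderiv i f x = 0 :=
  integral_deriv_translate hf.continuous (hf.pderiv i).continuous _ fun x s => hf.hasDerivAt i x s

end Smooth

/-- The `j`-th component as a continuous linear map. -/
abbrev comp (j : Fin 3) : Vec →L[ℝ] ℝ := EuclideanSpace.proj j

theorem IsSmooth.apply {v : Torus → Vec} (hv : IsSmooth v) (j : Fin 3) :
    IsSmooth (fun x => v x j) := hv.comp_clm (comp j)

theorem IsSmooth.pderiv_apply {v : Torus → Vec} (hv : IsSmooth v) (i j : Fin 3) (x : Torus) :
    HallMHD.pderiv i (fun x => v x j) x = HallMHD.pderiv i v x j :=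
  hv.pderiv_comp_clm (comp j) i x

theorem isSmooth_vec {v : Torus → Vec} (hv : ∀ j, IsSmooth (fun x => v x j)) : IsSmooth v :=
  contDiff_euclidean.2 hv

theorem inner_vec (a b : Vec) : inner ℝ a b = a 0 * b 0 + a 1 * b 1 + a 2 * b 2 := by
  simp [PiLp.inner_apply, Fin.sum_univ_three]; ring

theorem IsSmooth.curl {v : Torus → Vec} (hv : IsSmooth v) : IsSmooth (HallMHD.curl v) := by
  have h : ∀ i j, IsSmooth (fun x => HallMHD.pderiv i v x j) := fun i j => (hv.pderiv i).apply j
  refine isSmooth_vec fun j => ?_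
  fin_cases j
  · exact (h 1 2).sub (h 2 1)
  · exact (h 2 0).sub (h 0 2)
  · exact (h 0 1).sub (h 1 0)

theorem IsSmooth.div {v : Torus → Vec} (hv : IsSmooth v) : IsSmooth (HallMHD.div v) :=
  IsSmooth.sum fun i _ => (hv.pderiv i).apply i

/-- A smooth field that is orthogonal to itself vanishes identically. -/
theorem IsSmooth.eq_zero_of_integral_inner_self {F : Type*} [NormedAddCommGroup F]
    [InnerProductSpace ℝ F] {f : Torus → F} (hf : IsSmooth f)
    (h : ∫ x, inner ℝ (f x) (f x) = 0) : f = 0 := by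
  have hc : Continuous fun x => inner ℝ (f x) (f x) := hf.continuous.inner hf.continuous
  have h0 := (integral_eq_zero_iff_of_nonneg (fun x => real_inner_self_nonneg)
    (hc.integrable_of_hasCompactSupport (HasCompactSupport.of_compactSpace _))).1 h
  have h1 := Continuous.ae_eq_iff_eq (μ := volume) hc continuous_const |>.1 h0
  funext x
  exact inner_self_eq_zero.1 (congrFun h1 x)

/-! ### Mollification on the torus by kernels on `ℝ³` -/

/-- The reflection `(x, y) ↦ (x - y, -y)` of `𝕋³ × ℝ³`. -/
def shift (p : Torus × Vec) : Torus × Vec := (p.1 - toTorus p.2, -p.2)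

theorem shift_shift (p : Torus × Vec) : shift (shift p) = p := by
  simp [shift, toTorus_neg]

theorem measurable_shift : Measurable shift := by
  unfold shift; fun_prop

/-- `shift` as a measurable equivalence. -/
def shiftEquiv : Torus × Vec ≃ᵐ Torus × Vec where
  toFun := shift
  invFun := shift
  left_inv := shift_shift
  right_inv := shift_shift
  measurable_toFun := measurable_shift
  measurable_invFun := measurable_shift

/-- A skew product of `y ↦ -y` with translations of the torus. This one change of variables
exchanges the points `x` and `x - y`, and it is the source of every symmetry of mollification used
below. -/
theorem measurePreserving_shift :
    MeasurePreserving shift ((volume : Measure Torus).prod (volume : Measure Vec))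
      ((volume : Measure Torus).prod (volume : Measure Vec)) := by
  have h := MeasurePreserving.skew_product (μa := (volume : Measure Vec)) (μb := volume)
    (μc := (volume : Measure Torus)) (μd := volume) (f := fun y => -y)
    (Measure.measurePreserving_neg _) (g := fun y x => x - toTorus y) (by fun_prop)
    (Eventually.of_forall fun y => (measurePreserving_sub_right volume (toTorus y)).map_eq)
  exact (Measure.measurePreserving_swap.comp (h.comp Measure.measurePreserving_swap))

theorem integrable_comp_shift {F : Type*} [NormedAddCommGroup F] {G : Torus × Vec → F}
    (hG : Integrable G (volume.prod volume)) :
    Integrable (fun p => G (shift p)) (volume.prod volume) :=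
  (measurePreserving_shift.integrable_comp_emb shiftEquiv.measurableEmbedding).2 hG

theorem integral_comp_shift {F : Type*} [NormedAddCommGroup F] [NormedSpace ℝ F]
    (G : Torus × Vec → F) :
    ∫ p, G (shift p) ∂(volume.prod volume) = ∫ p, G p ∂(volume.prod volume) :=
  measurePreserving_shift.integral_comp shiftEquiv.measurableEmbedding G

theorem quasiMeasurePreserving_sub_toTorus :
    Measure.QuasiMeasurePreserving (fun p : Torus × Vec => p.1 - toTorus p.2)
      (volume.prod volume) volume :=
  Measure.quasiMeasurePreserving_fst.comp measurePreserving_shift.quasiMeasurePreserving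

theorem measurePreserving_sub_toTorus (y : Vec) :
    MeasurePreserving (fun x : Torus => x - toTorus y) volume volume :=
  measurePreserving_sub_right volume (toTorus y)

/-- Smooth compactly supported kernels on `ℝ³`. -/
structure IsKernel (K : Vec → ℝ) : Prop where
  smooth : ContDiff ℝ ∞ K
  compact : HasCompactSupport K

/-- The partial derivative of a kernel. -/
def dker (i : Fin 3) (K : Vec → ℝ) (y : Vec) : ℝ := fderiv ℝ K y (basisVec i)

theorem IsKernel.dker {K : Vec → ℝ} (hK : IsKernel K) (i : Fin 3) : IsKernel (dker i K) where
  smooth := (hK.smooth.fderiv_right (by simp)).clm_apply contDiff_const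
  compact := hK.compact.fderiv_apply ℝ (basisVec i)

theorem IsKernel.integrable {K : Vec → ℝ} (hK : IsKernel K) : Integrable K :=
  hK.smooth.continuous.integrable_of_hasCompactSupport hK.compact

theorem dker_neg {K : Vec → ℝ} (he : ∀ y, K (-y) = K y) (i : Fin 3) (y : Vec) :
    dker i K (-y) = -dker i K y := by
  have h : K = fun y => K (-y) := funext fun y => (he y).symm
  have h2 : fderiv ℝ K y = -fderiv ℝ K (-y) := by
    conv_lhs => rw [h]
    simpa using fderiv_comp_smul (𝕜 := ℝ) (f := K) (c := (-1 : ℝ)) (x := y)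
  simp [dker, h2]

section Moll

variable {F : Type*} [NormedAddCommGroup F] [NormedSpace ℝ F]

/-- The mollification `∫ K(y) f(x - y) dy` of `f : 𝕋³ → F` by a kernel on `ℝ³`. -/
def moll (K : Vec → ℝ) (f : Torus → F) (x : Torus) : F := ∫ y, K y • f (x - toTorus y)

variable {K : Vec → ℝ} {f g : Torus → F}

theorem integrable_kernel_smul (hK : Integrable K) (hf : Integrable f) :
    Integrable (fun p : Torus × Vec => K p.2 • f (p.1 - toTorus p.2)) (volume.prod volume) := by
  have h1 : Integrable (fun p : Torus × Vec => K (-p.2) • f p.1) (volume.prod volume) :=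
    (Integrable.smul_prod (μ := (volume : Measure Vec)) (ν := (volume : Measure Torus))
      (f := fun y => K (-y)) hK.comp_neg hf).swap
  simpa [shift] using integrable_comp_shift h1

/-- Fubini gives local integrability of `y ↦ f (x - y)` for almost every `x`. A single such `x`
suffices, because the lift differs from this function by a reflection and a translation. -/
theorem locallyIntegrable_lift (hf : Integrable f) :
    LocallyIntegrable (fun y : Vec => f (toTorus y)) := by
  have h1 : ∀ n : ℕ, ∀ᵐ x : Torus,
      Integrable (fun y : Vec => (Metric.closedBall (0 : Vec) n).indicator (fun _ => (1 : ℝ)) y •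
        f (x - toTorus y)) := fun n =>
    (integrable_kernel_smul ((integrable_indicator_iff Metric.isClosed_closedBall.measurableSet).2
      (integrableOn_const (isCompact_closedBall _ _).measure_lt_top.ne)) hf).prod_right_ae
  obtain ⟨x, hx⟩ := (ae_all_iff.2 h1).exists
  obtain ⟨y₀, rfl⟩ := surjective_toTorus x
  have h2 : LocallyIntegrable (fun y : Vec => f (toTorus y₀ - toTorus y)) := by
    rw [locallyIntegrable_iff]
    intro k hk
    obtain ⟨R, hR⟩ := hk.isBounded.subset_closedBall 0
    obtain ⟨n, hn⟩ := exists_nat_ge R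
    have h3 : IntegrableOn (fun y : Vec => f (toTorus y₀ - toTorus y)) (Metric.closedBall 0 n) := by
      rw [← integrable_indicator_iff Metric.isClosed_closedBall.measurableSet]
      refine (hx n).congr (Eventually.of_forall fun y => ?_)
      by_cases hy : y ∈ Metric.closedBall (0 : Vec) n
      · simp only [indicator_of_mem hy, one_smul]
      · simp only [indicator_of_notMem hy, zero_smul]
    exact h3.mono_set (hR.trans (Metric.closedBall_subset_closedBall hn))
  rw [locallyIntegrable_iff] at h2 ⊢
  intro k hk
  have hk' : IsCompact ((fun y => y₀ - y) '' k) := hk.image (by fun_prop)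
  have h4 := h2 _ hk'
  have hmp : MeasurePreserving (fun y : Vec => y₀ - y) :=
    Measure.measurePreserving_sub_left volume y₀
  rw [hmp.integrableOn_image (Homeomorph.subLeft y₀).measurableEmbedding] at h4
  refine h4.congr (Eventually.of_forall fun y => ?_)
  simp [toTorus_sub]

/-- Bridge to Euclidean convolution: smoothness and derivatives of `moll` are read off from the
convolution of the kernel with the periodic lift. -/
theorem moll_toTorus (y : Vec) :
    moll K f (toTorus y) =
      convolution K (fun y : Vec => f (toTorus y)) (ContinuousLinearMap.lsmul ℝ ℝ) volume y := by
  simp [moll, convolution, toTorus_sub]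

theorem integrable_moll (hK : IsKernel K) (hf : Integrable f) (x : Torus) :
    Integrable (fun y : Vec => K y • f (x - toTorus y)) := by
  obtain ⟨y, rfl⟩ := surjective_toTorus x
  have h := hK.compact.convolutionExists_left (ContinuousLinearMap.lsmul ℝ ℝ)
    hK.smooth.continuous (locallyIntegrable_lift hf) y
  simpa [ConvolutionExistsAt, toTorus_sub] using h

theorem isSmooth_moll [CompleteSpace F] (hK : IsKernel K) (hf : Integrable f) :
    IsSmooth (moll K f) := by
  unfold IsSmooth
  simp_rw [moll_toTorus]
  exact hK.compact.contDiff_convolution_left (n := ⊤) _ hK.smooth (locallyIntegrable_lift hf)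

theorem pderiv_moll [CompleteSpace F] (hK : IsKernel K) (hf : Integrable f) (i : Fin 3)
    (x : Torus) : pderiv i (moll K f) x = moll (dker i K) f x := by
  obtain ⟨y, rfl⟩ := surjective_toTorus x
  rw [(isSmooth_moll hK hf).pderiv_toTorus, moll_toTorus]
  have h1 := hK.compact.hasFDerivAt_convolution_left (ContinuousLinearMap.lsmul ℝ ℝ)
    (hK.smooth.of_le (by simp)) (locallyIntegrable_lift hf) y
  simp_rw [moll_toTorus]
  rw [h1.fderiv, convolution, convolution, ContinuousLinearMap.integral_apply]
  · simp [dker]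
  · exact (hK.compact.fderiv ℝ).convolutionExists_left _
      (hK.smooth.continuous_fderiv (by simp)) (locallyIntegrable_lift hf) y

theorem moll_sub (hK : IsKernel K) (hf : Integrable f) (hg : Integrable g) (x : Torus) :
    moll K (fun x => f x - g x) x = moll K f x - moll K g x := by
  simp only [moll, smul_sub]
  exact integral_sub (integrable_moll hK hf x) (integrable_moll hK hg x)

theorem moll_apply {v : Torus → Vec} (hK : IsKernel K) (hv : Integrable v) (j : Fin 3)
    (x : Torus) : moll K v x j = moll K (fun x => v x j) x :=
  ((comp j).integral_comp_comm (integrable_moll hK hv x)).symm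

end Moll

/-! ### Adjoints of mollification in `L²` -/

section Duality

variable {F : Type*} [NormedAddCommGroup F] [InnerProductSpace ℝ F]
variable {K : Vec → ℝ} {f g : Torus → F}

theorem integrable_kernel_inner (hK : Integrable K) (hf : MemLp f 2 volume)
    (hg : MemLp g 2 volume) :
    Integrable (fun p : Torus × Vec => K p.2 * inner ℝ (f p.1) (g (p.1 - toTorus p.2)))
      (volume.prod volume) := by
  have h1 : Integrable (fun p : Torus × Vec => |K p.2| * ‖f p.1‖ ^ 2) (volume.prod volume) :=
    (Integrable.smul_prod (μ := (volume : Measure Vec)) (ν := (volume : Measure Torus))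
      hK.abs (hf.integrable_norm_pow (by simp))).swap
  have h2 : Integrable (fun p : Torus × Vec => |K p.2| * ‖g (p.1 - toTorus p.2)‖ ^ 2)
      (volume.prod volume) :=
    integrable_kernel_smul (f := fun x => ‖g x‖ ^ 2) hK.abs (hg.integrable_norm_pow (by simp))
  refine (h1.add h2).mono' ?_ (Eventually.of_forall fun p => ?_)
  · exact hK.aestronglyMeasurable.comp_snd.mul (hf.1.comp_fst.inner
      (hg.1.comp_quasiMeasurePreserving quasiMeasurePreserving_sub_toTorus))
  · have h3 := norm_inner_le_norm (𝕜 := ℝ) (f p.1) (g (p.1 - toTorus p.2))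
    rw [norm_mul, Real.norm_eq_abs]
    simp only [Pi.add_apply]
    rw [← mul_add]
    refine mul_le_mul_of_nonneg_left ?_ (abs_nonneg _)
    nlinarith [sq_nonneg (‖f p.1‖ - ‖g (p.1 - toTorus p.2)‖), sq_nonneg ‖f p.1‖,
      sq_nonneg ‖g (p.1 - toTorus p.2)‖]

theorem integral_inner_moll [CompleteSpace F] (hK : IsKernel K) (hf : MemLp f 2 volume) (hg : MemLp g 2 volume) :
    ∫ x, inner ℝ (f x) (moll K g x) =
      ∫ p : Torus × Vec, K p.2 * inner ℝ (f p.1) (g (p.1 - toTorus p.2))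
        ∂(volume.prod volume) := by
  rw [integral_prod _ (integrable_kernel_inner hK.integrable hf hg)]
  refine integral_congr_ae (Eventually.of_forall fun x => ?_)
  simp only [moll]
  rw [← integral_inner (integrable_moll hK (hg.integrable (by simp)) x)]
  simp_rw [real_inner_smul_right]

/-- The `shift` substitution moves the mollification to the other factor. The parity `c` is `1` for
an even kernel and `-1` for its partial derivatives, where the formula becomes integration by parts.
-/
theorem integral_inner_moll_comm [CompleteSpace F] (hK : IsKernel K) (hf : MemLp f 2 volume)
    (hg : MemLp g 2 volume) {c : ℝ} (hc : ∀ y, K (-y) = c * K y) :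
    ∫ x, inner ℝ (f x) (moll K g x) = c * ∫ x, inner ℝ (moll K f x) (g x) := by
  have h0 : ∀ x, inner ℝ (moll K f x) (g x) = inner ℝ (g x) (moll K f x) :=
    fun x => real_inner_comm _ _
  simp_rw [h0]
  rw [integral_inner_moll hK hf hg, integral_inner_moll hK hg hf, ← integral_comp_shift,
    ← integral_const_mul]
  refine integral_congr_ae (Eventually.of_forall fun p => ?_)
  simp only [shift, toTorus_neg, hc, sub_neg_eq_add, sub_add_cancel]
  rw [real_inner_comm]; ring

end Duality

/-! ### Divergence and curl of mollified fields -/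

theorem memLp_apply {v : Torus → Vec} {p : ℝ≥0∞} (hv : MemLp v p volume) (j : Fin 3) :
    MemLp (fun x => v x j) p volume := (comp j).comp_memLp' hv

theorem integrable_inner_of_memLp_two {F : Type*} [NormedAddCommGroup F] [InnerProductSpace ℝ F]
    {f g : Torus → F} (hf : MemLp f 2 volume) (hg : MemLp g 2 volume) :
    Integrable fun x => inner ℝ (f x) (g x) :=
  (hf.norm.integrable_mul hg.norm).mono' (hf.1.inner hg.1)
    (Eventually.of_forall fun _ => norm_inner_le_norm _ _)

theorem pderiv_moll_apply {K : Vec → ℝ} (hK : IsKernel K) {v : Torus → Vec}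
    (hv : Integrable v) (i j : Fin 3) (x : Torus) :
    pderiv i (moll K v) x j = moll (dker i K) (fun x => v x j) x := by
  rw [pderiv_moll hK hv, moll_apply (hK.dker i) hv]

/-- Integration by parts against a mollified function. -/
theorem integral_mul_moll_dker {K : Vec → ℝ} (hK : IsKernel K) (he : ∀ y, K (-y) = K y)
    {f g : Torus → ℝ} (hf : MemLp f 2 volume) (hg : MemLp g 2 volume) (i : Fin 3) :
    ∫ x, f x * moll (dker i K) g x = -∫ x, g x * moll (dker i K) f x := by
  have h := integral_inner_moll_comm (hK.dker i) hf hg (c := -1)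
    (fun y => by rw [dker_neg he]; ring)
  simp only [RCLike.inner_apply, conj_trivial, neg_mul, one_mul] at h
  simp_rw [mul_comm (f _)]
  exact h

theorem integrable_mul_moll {K : Vec → ℝ} (hK : IsKernel K) {f g : Torus → ℝ}
    (hf : MemLp f 2 volume) (hg : MemLp g 2 volume) :
    Integrable fun x => f x * moll K g x :=
  hf.integrable_mul ((isSmooth_moll hK (hg.integrable (by simp))).memLp 2)

/-- With `ψ` the divergence in question, duality turns `∫ ψ²` into minus the weak divergence of `v`
tested against `moll K ψ`, which is zero. A smooth function with `∫ ψ² = 0` vanishes everywhere. -/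
theorem div_moll {K : Vec → ℝ} (hK : IsKernel K) (he : ∀ y, K (-y) = K y) {v : Torus → Vec}
    (hv : MemLp v 2 volume) (hd : IsDivFree v) (x : Torus) : div (moll K v) x = 0 := by
  have hvi : Integrable v := hv.integrable (by simp)
  have hs : IsSmooth (div (moll K v)) := (isSmooth_moll hK hvi).div
  refine congrFun (hs.eq_zero_of_integral_inner_self ?_) x
  set ψ := div (moll K v) with hψ
  have hψ2 : MemLp ψ 2 volume := hs.memLp 2
  have hψi : Integrable ψ := hψ2.integrable (by simp)
  have h1 : ∀ x, inner ℝ (ψ x) (ψ x) = ∑ i, ψ x * moll (dker i K) (fun x => v x i) x := by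
    intro x
    rw [← Finset.mul_sum]
    simp only [RCLike.inner_apply, conj_trivial]
    congr 1
    exact Finset.sum_congr rfl fun i _ => pderiv_moll_apply hK hvi i i x
  have h2 := hd _ (isSmooth_moll hK hψi)
  simp_rw [pderiv_moll hK hψi] at h2
  rw [integral_finsetSum _ fun i _ => integrable_mul_moll (hK.dker i) (memLp_apply hv i) hψ2] at h2
  simp_rw [h1]
  rw [integral_finsetSum _ fun i _ => integrable_mul_moll (hK.dker i) hψ2 (memLp_apply hv i)]
  simp_rw [integral_mul_moll_dker hK he hψ2 (memLp_apply hv _)]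
  rw [Finset.sum_neg_distrib, h2, neg_zero]

theorem integral_inner_curl_moll {K : Vec → ℝ} (hK : IsKernel K) {φ v : Torus → Vec}
    (hφ : MemLp φ 2 volume) (hv : MemLp v 2 volume) :
    ∫ x, inner ℝ (φ x) (curl (moll K v) x) =
      (∫ x, φ x 0 * moll (dker 1 K) (fun x => v x 2) x)
      - (∫ x, φ x 0 * moll (dker 2 K) (fun x => v x 1) x)
      + ((∫ x, φ x 1 * moll (dker 2 K) (fun x => v x 0) x)
      - (∫ x, φ x 1 * moll (dker 0 K) (fun x => v x 2) x))
      + ((∫ x, φ x 2 * moll (dker 0 K) (fun x => v x 1) x)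
      - (∫ x, φ x 2 * moll (dker 1 K) (fun x => v x 0) x)) := by
  have hi : ∀ a i b, Integrable fun x => φ x a * moll (dker i K) (fun x => v x b) x :=
    fun a i b => integrable_mul_moll (hK.dker i) (memLp_apply hφ a) (memLp_apply hv b)
  have hd : ∀ a i b j c, Integrable fun x => φ x a * moll (dker i K) (fun x => v x b) x -
      φ x a * moll (dker j K) (fun x => v x c) x := fun a i b j c => (hi a i b).sub (hi a j c)
  have hd2 : Integrable fun x => (φ x 0 * moll (dker 1 K) (fun x => v x 2) x -
      φ x 0 * moll (dker 2 K) (fun x => v x 1) x) + (φ x 1 * moll (dker 2 K) (fun x => v x 0) x -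
      φ x 1 * moll (dker 0 K) (fun x => v x 2) x) := (hd 0 1 2 2 1).add (hd 1 2 0 0 2)
  rw [← integral_sub (hi _ _ _) (hi _ _ _), ← integral_sub (hi _ _ _) (hi _ _ _),
    ← integral_sub (hi _ _ _) (hi _ _ _), ← integral_add (hd _ _ _ _ _) (hd _ _ _ _ _),
    ← integral_add hd2 (hd _ _ _ _ _)]
  refine integral_congr_ae (Eventually.of_forall fun x => ?_)
  have hvi : Integrable v := hv.integrable (by simp)
  simp only [inner_vec, curl, pderiv_moll_apply hK hvi]
  simp
  ring

/-- Same device as for the divergence: the difference `φ` of the two sides is smooth, and moving the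
kernel onto `φ` makes `∫ |φ|²` the defect in the weak curl identity for the test field `moll K φ`.
-/
theorem curl_moll {K : Vec → ℝ} (hK : IsKernel K) (he : ∀ y, K (-y) = K y) {v w : Torus → Vec}
    (hv : MemLp v 2 volume) (hw : MemLp w 2 volume) (hc : HasWeakCurl v w) (x : Torus) :
    curl (moll K v) x = moll K w x := by
  have hvi : Integrable v := hv.integrable (by simp)
  have hwi : Integrable w := hw.integrable (by simp)
  have hs1 := (isSmooth_moll hK hvi).curl
  have hs2 := isSmooth_moll hK hwi
  have hs : IsSmooth (fun x => curl (moll K v) x - moll K w x) := hs1.sub hs2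
  refine sub_eq_zero.1 (congrFun (hs.eq_zero_of_integral_inner_self ?_) x)
  set φ : Torus → Vec := fun x => curl (moll K v) x - moll K w x with hφ
  have hφ2 : MemLp φ 2 volume := hs.memLp 2
  have h1 : ∫ x, inner ℝ (φ x) (curl (moll K v) x) = ∫ x, inner ℝ (v x) (curl (moll K φ) x) := by
    rw [integral_inner_curl_moll hK hφ2 hv, integral_inner_curl_moll hK hv hφ2]
    simp_rw [integral_mul_moll_dker hK he (memLp_apply hφ2 _) (memLp_apply hv _)]
    ring
  have h2 : ∫ x, inner ℝ (φ x) (moll K w x) = ∫ x, inner ℝ (w x) (moll K φ x) := by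
    rw [integral_inner_moll_comm hK hφ2 hw (c := 1) (fun y => by rw [he, one_mul]), one_mul]
    exact integral_congr_ae (Eventually.of_forall fun x => real_inner_comm _ _)
  have h3 := hc _ (isSmooth_moll hK (hφ2.integrable (by simp)))
  have h4 : ∀ x, inner ℝ (φ x) (φ x) =
      inner ℝ (φ x) (curl (moll K v) x) - inner ℝ (φ x) (moll K w x) := by
    intro x; rw [← inner_sub_right]
  change ∫ x, inner ℝ (φ x) (φ x) = 0
  rw [integral_congr_ae (Eventually.of_forall h4)]
  rw [integral_sub (integrable_inner_of_memLp_two hφ2 (hs1.memLp 2))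
    (integrable_inner_of_memLp_two hφ2 (hs2.memLp 2)), h1, h2, h3, sub_self]

/-! ### The cubic identity for the Hall term -/

section Cubic

variable {f : Torus → Vec} {L : Vec → ℝ}

theorem abs_apply_le (a : Vec) (i : Fin 3) : |a i| ≤ ‖a‖ := PiLp.norm_apply_le a i

theorem integrable_kernel_cubic (hL : Integrable L) (hf : MemLp f 3 volume)
    {P : Vec → Vec → ℝ} (hP : Continuous (Function.uncurry P)) {C : ℝ}
    (hC : ∀ a b, |P a b| ≤ C * (‖a‖ + ‖b‖) ^ 3) :
    Integrable (fun p : Torus × Vec => L p.2 * P (f p.1) (f (p.1 - toTorus p.2)))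
      (volume.prod volume) := by
  have h3 : Integrable fun x => ‖f x‖ ^ 3 := hf.integrable_norm_pow (by simp)
  have h1 : Integrable (fun p : Torus × Vec => |L p.2| * ‖f p.1‖ ^ 3) (volume.prod volume) :=
    (Integrable.smul_prod (μ := (volume : Measure Vec)) (ν := (volume : Measure Torus))
      hL.abs h3).swap
  have h2 : Integrable (fun p : Torus × Vec => |L p.2| * ‖f (p.1 - toTorus p.2)‖ ^ 3)
      (volume.prod volume) := integrable_kernel_smul (f := fun x => ‖f x‖ ^ 3) hL.abs h3
  refine (((h1.add h2).const_mul 4).const_mul |C|).mono' ?_ (Eventually.of_forall fun p => ?_)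
  · exact hL.aestronglyMeasurable.comp_snd.mul (hP.comp_aestronglyMeasurable
      (hf.1.comp_fst.prodMk
        (hf.1.comp_quasiMeasurePreserving quasiMeasurePreserving_sub_toTorus)))
  · rw [norm_mul, Real.norm_eq_abs, Real.norm_eq_abs]
    simp only [Pi.add_apply]
    set a := ‖f p.1‖ with ha
    set b := ‖f (p.1 - toTorus p.2)‖ with hb
    have ha0 : 0 ≤ a := norm_nonneg _
    have hb0 : 0 ≤ b := norm_nonneg _
    have h4 : (a + b) ^ 3 ≤ 4 * (a ^ 3 + b ^ 3) := by
      nlinarith [mul_nonneg (add_nonneg ha0 hb0) (sq_nonneg (a - b))]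
    have h5 : |P (f p.1) (f (p.1 - toTorus p.2))| ≤ |C| * (4 * (a ^ 3 + b ^ 3)) :=
      (hC _ _).trans (mul_le_mul (le_abs_self C) h4 (by positivity) (abs_nonneg _))
    calc _ ≤ |L p.2| * (|C| * (4 * (a ^ 3 + b ^ 3))) :=
          mul_le_mul_of_nonneg_left h5 (abs_nonneg _)
      _ = _ := by ring

theorem abs_apply_mul_le {a b c d e : Vec} {r : ℝ} (i : Fin 3) (hr : |r| ≤ ‖c‖ * ‖d‖)
    (hc : c = a ∨ c = b) (hd : d = a ∨ d = b) (he : e = a ∨ e = b) :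
    |e i * r| ≤ 1 * (‖a‖ + ‖b‖) ^ 3 := by
  have h : ∀ c, c = a ∨ c = b → ‖c‖ ≤ ‖a‖ + ‖b‖ := by
    rintro c (rfl | rfl)
    · exact le_add_of_nonneg_right (norm_nonneg _)
    · exact le_add_of_nonneg_left (norm_nonneg _)
  rw [abs_mul, one_mul]
  calc |e i| * |r| ≤ (‖a‖ + ‖b‖) * ((‖a‖ + ‖b‖) * (‖a‖ + ‖b‖)) :=
        mul_le_mul ((abs_apply_le e i).trans (h e he))
          (hr.trans (mul_le_mul (h c hc) (h d hd) (norm_nonneg _) (by positivity))) (abs_nonneg _)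
          (by positivity)
    _ = _ := by ring

theorem abs_norm_sq_le (a : Vec) : |‖a‖ ^ 2| ≤ ‖a‖ * ‖a‖ := by
  rw [abs_of_nonneg (by positivity), sq]

theorem integral_kernel_swap (hodd : ∀ y, L (-y) = -L y) (P : Vec → Vec → ℝ) :
    ∫ p : Torus × Vec, L p.2 * P (f p.1) (f (p.1 - toTorus p.2)) ∂(volume.prod volume) =
      -∫ p : Torus × Vec, L p.2 * P (f (p.1 - toTorus p.2)) (f p.1) ∂(volume.prod volume) := by
  rw [← integral_comp_shift, ← integral_neg]
  refine integral_congr_ae (Eventually.of_forall fun p => ?_)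
  simp only [shift, toTorus_neg, hodd, sub_neg_eq_add, sub_add_cancel]
  ring

theorem integral_odd_kernel (hodd : ∀ y, L (-y) = -L y) : ∫ y, L y = 0 := by
  have h := integral_neg_eq_self L volume
  simp_rw [hodd, integral_neg] at h
  linarith

/-- Write `a = f(x)`, `b = f(x - y)` and expand `(a_i - b_i)|a - b|²`. Against an odd kernel,
exchanging `a` and `b` changes the sign of an integral. So `a_i |a|²` and `b_i |b|²` contribute
nothing, and the four mixed terms pair up into two. -/
theorem integral_odd_kernel_cubic (hL : Integrable L) (hf : MemLp f 3 volume)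
    (hodd : ∀ y, L (-y) = -L y) (i : Fin 3) :
    ∫ p : Torus × Vec, L p.2 * ((f p.1 i - f (p.1 - toTorus p.2) i) *
        ‖f p.1 - f (p.1 - toTorus p.2)‖ ^ 2) ∂(volume.prod volume) =
      -4 * (∫ p : Torus × Vec, L p.2 * (f p.1 i * inner ℝ (f p.1) (f (p.1 - toTorus p.2)))
        ∂(volume.prod volume))
      - 2 * ∫ p : Torus × Vec, L p.2 * (f (p.1 - toTorus p.2) i * ‖f p.1‖ ^ 2)
        ∂(volume.prod volume) := by
  have hI : ∀ P : Vec → Vec → ℝ, Continuous (Function.uncurry P) →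
      (∀ a b, |P a b| ≤ 1 * (‖a‖ + ‖b‖) ^ 3) →
      Integrable (fun p : Torus × Vec => L p.2 * P (f p.1) (f (p.1 - toTorus p.2)))
        (volume.prod volume) := fun P hP hC => integrable_kernel_cubic hL hf hP hC
  have i1 := hI (fun a b => a i * ‖a‖ ^ 2) (by simp only [Function.uncurry_def]; fun_prop)
    fun a b => abs_apply_mul_le (e := a) i (abs_norm_sq_le a) (by simp) (by simp) (by simp)
  have i2 := hI (fun a b => a i * inner ℝ a b) (by simp only [Function.uncurry_def]; fun_prop)
    fun a b => abs_apply_mul_le (e := a) i (abs_real_inner_le_norm a b) (by simp) (by simp) (by simp)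
  have i3 := hI (fun a b => a i * ‖b‖ ^ 2) (by simp only [Function.uncurry_def]; fun_prop)
    fun a b => abs_apply_mul_le (e := a) i (abs_norm_sq_le b) (by simp) (by simp) (by simp)
  have i4 := hI (fun a b => b i * ‖a‖ ^ 2) (by simp only [Function.uncurry_def]; fun_prop)
    fun a b => abs_apply_mul_le (e := b) i (abs_norm_sq_le a) (by simp) (by simp) (by simp)
  have i5 := hI (fun a b => b i * inner ℝ b a) (by simp only [Function.uncurry_def]; fun_prop)
    fun a b => abs_apply_mul_le (e := b) i (abs_real_inner_le_norm b a) (by simp) (by simp) (by simp)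
  have i6 := hI (fun a b => b i * ‖b‖ ^ 2) (by simp only [Function.uncurry_def]; fun_prop)
    fun a b => abs_apply_mul_le (e := b) i (abs_norm_sq_le b) (by simp) (by simp) (by simp)
  have s1 := integral_kernel_swap (f := f) hodd (fun a b => a i * ‖a‖ ^ 2)
  have s2 := integral_kernel_swap (f := f) hodd (fun a b => a i * inner ℝ a b)
  have s3 := integral_kernel_swap (f := f) hodd (fun a b => a i * ‖b‖ ^ 2)
  have z1 : ∫ p : Torus × Vec, L p.2 * (f p.1 i * ‖f p.1‖ ^ 2) ∂(volume.prod volume) = 0 := by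
    simp_rw [mul_comm (L _)]
    rw [integral_prod_mul (fun x => f x i * ‖f x‖ ^ 2) L, integral_odd_kernel hodd, mul_zero]
  simp only at s1 s2 s3 i1 i2 i3 i4 i5 i6
  have hexp : ∀ p : Torus × Vec, L p.2 * ((f p.1 i - f (p.1 - toTorus p.2) i) *
        ‖f p.1 - f (p.1 - toTorus p.2)‖ ^ 2) =
      (L p.2 * (f p.1 i * ‖f p.1‖ ^ 2)
        - 2 * (L p.2 * (f p.1 i * inner ℝ (f p.1) (f (p.1 - toTorus p.2)))))
      + (L p.2 * (f p.1 i * ‖f (p.1 - toTorus p.2)‖ ^ 2)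
        - L p.2 * (f (p.1 - toTorus p.2) i * ‖f p.1‖ ^ 2))
      + (2 * (L p.2 * (f (p.1 - toTorus p.2) i * inner ℝ (f (p.1 - toTorus p.2)) (f p.1)))
        - L p.2 * (f (p.1 - toTorus p.2) i * ‖f (p.1 - toTorus p.2)‖ ^ 2)) := by
    intro p
    rw [norm_sub_sq_real, real_inner_comm (f p.1)]
    ring
  simp_rw [hexp]
  have j1 := i1.sub (i2.const_mul 2)
  have j2 := i3.sub i4
  have j3 := (i5.const_mul 2).sub i6
  refine (integral_add (j1.add j2) j3).trans ?_
  rw [integral_add' j1 j2, integral_sub' i1 (i2.const_mul 2), integral_sub' i3 i4,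
    integral_sub' (i5.const_mul 2) i6,
    integral_const_mul, integral_const_mul]
  linarith

/-- After summation over `i`, one of the two mixed terms is the Hall integral and the other contains
`div (moll K f) = 0`. The gain is that the right-hand side is cubic in increments of `f`, although
the left-hand side contains `f` itself. -/
theorem integral_gradContract_moll {K : Vec → ℝ} (hK : IsKernel K) (he : ∀ y, K (-y) = K y)
    (hf : MemLp f 3 volume) (hd : IsDivFree f) :
    4 * ∫ x, gradContract (moll K f) (f x) (f x) x =
      -∑ i, ∫ p : Torus × Vec, dker i K p.2 * ((f p.1 i - f (p.1 - toTorus p.2) i) *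
        ‖f p.1 - f (p.1 - toTorus p.2)‖ ^ 2) ∂(volume.prod volume) := by
  have hfi : Integrable f := hf.integrable (by norm_num)
  have hf2 : MemLp f 2 volume := hf.mono_exponent (by norm_num)
  simp_rw [fun i => integral_odd_kernel_cubic (hK.dker i).integrable hf (dker_neg he i) i]
  rw [Finset.sum_sub_distrib, ← Finset.mul_sum, ← Finset.mul_sum]
  have i2 := fun i => integrable_kernel_cubic (hK.dker i).integrable hf
    (P := fun a b => a i * inner ℝ a b) (by simp only [Function.uncurry_def]; fun_prop)
    fun a b => abs_apply_mul_le (e := a) i (abs_real_inner_le_norm a b) (by simp) (by simp) (by simp)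
  have i4 := fun i => integrable_kernel_cubic (hK.dker i).integrable hf
    (P := fun a b => b i * ‖a‖ ^ 2) (by simp only [Function.uncurry_def]; fun_prop)
    fun a b => abs_apply_mul_le (e := b) i (abs_norm_sq_le a) (by simp) (by simp) (by simp)
  simp only at i2 i4
  -- Integrating in `y` first leaves `div (moll K f) x * ‖f x‖ ^ 2`.
  have e4 : ∑ i, ∫ p : Torus × Vec, dker i K p.2 * (f (p.1 - toTorus p.2) i * ‖f p.1‖ ^ 2)
      ∂(volume.prod volume) = 0 := by
    simp_rw [fun i => integral_prod _ (i4 i)]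
    rw [← integral_finsetSum _ fun i _ => (i4 i).integral_prod_left]
    refine (integral_congr_ae (Eventually.of_forall fun x => ?_)).trans (integral_zero _ _)
    have h0 := div_moll hK he hf2 hd x
    simp only [div, pderiv_moll_apply hK hfi] at h0
    simp only [← mul_assoc, integral_mul_const]
    rw [← Finset.sum_mul]
    have h1 : ∑ i, ∫ y, dker i K y * f (x - toTorus y) i = 0 := h0
    rw [h1]; simp
  have e2 : ∑ i, ∫ p : Torus × Vec, dker i K p.2 *
      (f p.1 i * inner ℝ (f p.1) (f (p.1 - toTorus p.2))) ∂(volume.prod volume) =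
      ∫ x, gradContract (moll K f) (f x) (f x) x := by
    simp_rw [fun i => integral_prod _ (i2 i)]
    rw [← integral_finsetSum _ fun i _ => (i2 i).integral_prod_left]
    refine integral_congr_ae (Eventually.of_forall fun x => ?_)
    simp only [gradContract]
    refine Finset.sum_congr rfl fun i _ => ?_
    have h1 : ∀ y, dker i K y * (f x i * inner ℝ (f x) (f (x - toTorus y))) =
        f x i * inner ℝ (f x) (dker i K y • f (x - toTorus y)) := fun y => by
      rw [real_inner_smul_right]; ring
    simp_rw [h1]
    rw [integral_const_mul, integral_inner (integrable_moll (hK.dker i) hfi x)]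
    change f x i * inner ℝ (f x) (moll (dker i K) f x) = _
    rw [pderiv_moll hK hfi, inner_vec, Fin.sum_univ_three]
    ring
  rw [e4, e2]
  ring

end Cubic

/-! ### The flux of helicity and its estimates -/

/-- The determinant `w · (a × b)`. -/
def det3 (w a b : Vec) : ℝ :=
  w 0 * (a 1 * b 2 - a 2 * b 1) + w 1 * (a 2 * b 0 - a 0 * b 2) + w 2 * (a 0 * b 1 - a 1 * b 0)

/-- The density `w · (a × b) + b · (b · ∇) w`; for `w = curl ψ`, `a = u`, `b = h` this is the
nonlinearity of the induction equation tested with `ψ`. -/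
def flux (w : Torus → Vec) (a b : Vec) (x : Torus) : ℝ :=
  det3 (w x) a b + gradContract w b b x

/-- The antisymmetric part of a gradient is its curl, so the ideal nonlinearity depends on the test
field only through its curl, as the Hall term already does. -/
theorem gradContract_sub_gradContract (ψ : Torus → Vec) (a b : Vec) (x : Torus) :
    gradContract ψ b a x - gradContract ψ a b x = det3 (curl ψ x) a b := by
  simp [gradContract, det3, curl, Fin.sum_univ_three]
  ring

theorem gradContract_eq_sum_inner (v : Torus → Vec) (b : Vec) (x : Torus) :
    gradContract v b b x = ∑ i, b i * inner ℝ b (pderiv i v x) := by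
  refine Finset.sum_congr rfl fun i _ => ?_
  rw [inner_vec, Fin.sum_univ_three]
  ring

theorem abs_det3_le (w a b : Vec) : |det3 w a b| ≤ 6 * ((‖a‖ + ‖b‖) ^ 2 * ‖w‖) := by
  have h : ∀ i j k, |w i * (a j * b k)| ≤ ‖w‖ * (‖a‖ * ‖b‖) := fun i j k => by
    rw [abs_mul, abs_mul]
    exact mul_le_mul (abs_apply_le w i) (mul_le_mul (abs_apply_le a j) (abs_apply_le b k)
      (abs_nonneg _) (norm_nonneg _)) (by positivity) (norm_nonneg _)
  have h2 : ‖w‖ * (‖a‖ * ‖b‖) ≤ (‖a‖ + ‖b‖) ^ 2 * ‖w‖ := by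
    have := norm_nonneg w
    nlinarith [norm_nonneg a, norm_nonneg b, mul_nonneg (norm_nonneg a) (norm_nonneg b),
      mul_nonneg this (sq_nonneg ‖a‖), mul_nonneg this (sq_nonneg ‖b‖),
      mul_nonneg this (mul_nonneg (norm_nonneg a) (norm_nonneg b))]
  have e : det3 w a b = w 0 * (a 1 * b 2) - w 0 * (a 2 * b 1) + (w 1 * (a 2 * b 0)
      - w 1 * (a 0 * b 2)) + (w 2 * (a 0 * b 1) - w 2 * (a 1 * b 0)) := by
    rw [det3]; ring
  rw [e]
  have := abs_le.1 (h 0 1 2)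
  have := abs_le.1 (h 0 2 1)
  have := abs_le.1 (h 1 2 0)
  have := abs_le.1 (h 1 0 2)
  have := abs_le.1 (h 2 0 1)
  have := abs_le.1 (h 2 1 0)
  rw [abs_le]
  constructor <;> linarith

theorem enorm_det3_le (w a b : Vec) : ‖det3 w a b‖ₑ ≤ 6 * ((‖a‖ₑ + ‖b‖ₑ) ^ 2 * ‖w‖ₑ) := by
  have h := ENNReal.ofReal_le_ofReal (abs_det3_le w a b)
  rw [← Real.norm_eq_abs, ofReal_norm, ENNReal.ofReal_mul (by norm_num),
    ENNReal.ofReal_mul (by positivity), ENNReal.ofReal_pow (by positivity),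
    ENNReal.ofReal_add (norm_nonneg _) (norm_nonneg _), ofReal_norm, ofReal_norm,
    ofReal_norm] at h
  simpa using h

theorem det3_sub (w w' a b : Vec) : det3 (w - w') a b = det3 w a b - det3 w' a b := by
  simp [det3]; ring

theorem det3_self (a b : Vec) : det3 b a b = 0 := by
  simp [det3]; ring

theorem abs_gradContract_le (v : Torus → Vec) (a b : Vec) (x : Torus) :
    |gradContract v a b x| ≤ (∑ i, ‖pderiv i v x‖) * (3 * (‖a‖ * ‖b‖)) := by
  rw [gradContract, Finset.sum_mul]
  refine (Finset.abs_sum_le_sum_abs _ _).trans (Finset.sum_le_sum fun i _ => ?_)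
  refine (Finset.abs_sum_le_sum_abs _ _).trans ?_
  have h : ∀ j, |pderiv i v x j * a j * b i| ≤ ‖pderiv i v x‖ * (‖a‖ * ‖b‖) := fun j => by
    rw [mul_assoc, abs_mul, abs_mul]
    exact mul_le_mul (abs_apply_le _ j) (mul_le_mul (abs_apply_le a j) (abs_apply_le b i)
      (abs_nonneg _) (norm_nonneg _)) (by positivity) (norm_nonneg _)
  refine (Finset.sum_le_sum fun j _ => h j).trans ?_
  simp
  exact le_of_eq (by ring)

theorem enorm_gradContract_le (v : Torus → Vec) (b : Vec) (x : Torus) :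
    ‖gradContract v b b x‖ₑ ≤ ‖b‖ₑ ^ 2 * ∑ i, ‖pderiv i v x‖ₑ := by
  rw [gradContract_eq_sum_inner, Finset.mul_sum]
  refine (enorm_sum_le _ _).trans (Finset.sum_le_sum fun i _ => ?_)
  have h : ‖b i * inner ℝ b (pderiv i v x)‖ ≤ ‖b‖ ^ 2 * ‖pderiv i v x‖ := by
    rw [norm_mul, sq, mul_assoc]
    exact mul_le_mul (abs_apply_le b i) (norm_inner_le_norm _ _) (norm_nonneg _) (norm_nonneg _)
  have h2 := ENNReal.ofReal_le_ofReal h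
  rwa [ofReal_norm, ENNReal.ofReal_mul (by positivity), ENNReal.ofReal_pow (norm_nonneg _),
    ofReal_norm, ofReal_norm] at h2

theorem integrable_det3 {w : Torus → Vec} (hw : IsSmooth w) {a b : Torus → Vec}
    (ha : MemLp a 2 volume) (hb : MemLp b 2 volume) :
    Integrable fun x => det3 (w x) (a x) (b x) := by
  obtain ⟨C, hC⟩ := hw.exists_bound
  have h1 : Integrable fun x => (‖a x‖ + ‖b x‖) ^ 2 :=
    (ha.norm.add hb.norm).integrable_sq
  have hm : Continuous fun p : Vec × Vec × Vec => det3 p.1 p.2.1 p.2.2 := by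
    unfold det3; fun_prop
  refine ((h1.mul_const C).const_mul 6).mono' (hm.comp_aestronglyMeasurable
    (hw.continuous.aestronglyMeasurable.prodMk (ha.1.prodMk hb.1)))
    (Eventually.of_forall fun x => (abs_det3_le _ _ _).trans ?_)
  have := hC x
  gcongr

theorem integrable_gradContract {w : Torus → Vec} (hw : IsSmooth w) {a b : Torus → Vec}
    (ha : MemLp a 2 volume) (hb : MemLp b 2 volume) :
    Integrable fun x => gradContract w (a x) (b x) x := by
  unfold gradContract
  refine integrable_finsetSum _ fun i _ => integrable_finsetSum _ fun j _ => ?_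
  obtain ⟨C, hC⟩ := ((hw.pderiv i).apply j).exists_bound
  have h1 : Integrable fun x => a x j * b x i := (memLp_apply ha j).integrable_mul (memLp_apply hb i)
  simp_rw [mul_assoc]
  exact h1.bdd_mul ((hw.pderiv i).apply j).continuous.aestronglyMeasurable
    (Eventually.of_forall hC)

theorem integrable_flux {w : Torus → Vec} (hw : IsSmooth w) {a b : Torus → Vec}
    (ha : MemLp a 2 volume) (hb : MemLp b 2 volume) :
    Integrable fun x => flux w (a x) (b x) x :=
  (integrable_det3 hw ha hb).add (integrable_gradContract hw hb hb)

theorem enorm_moll_le {F : Type*} [NormedAddCommGroup F] [NormedSpace ℝ F] (K : Vec → ℝ)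
    (g : Torus → F) (x : Torus) :
    ‖moll K g x‖ₑ ≤ ∫⁻ y, ‖K y‖ₑ * ‖g (x - toTorus y)‖ₑ := by
  refine (enorm_integral_le_lintegral_enorm _).trans (le_of_eq ?_)
  simp_rw [enorm_smul]

/-- The first summand dominates when `c ≤ κ * s`, the second otherwise. -/
theorem young_cubic (s c κ : ℝ≥0∞) (h0 : κ ≠ 0) (h1 : κ ≠ ⊤) :
    s ^ 2 * c ≤ κ * s ^ 3 + κ⁻¹ ^ 2 * c ^ 3 := by
  rcases le_total c (κ * s) with h | h
  · refine le_add_right ?_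
    calc s ^ 2 * c ≤ s ^ 2 * (κ * s) := by gcongr
      _ = κ * s ^ 3 := by ring
  · refine le_add_left ?_
    have h2 : s ≤ κ⁻¹ * c := by
      calc s = κ⁻¹ * (κ * s) := by rw [← mul_assoc, ENNReal.inv_mul_cancel h0 h1, one_mul]
        _ ≤ κ⁻¹ * c := by gcongr
    calc s ^ 2 * c ≤ (κ⁻¹ * c) ^ 2 * c := by gcongr
      _ = κ⁻¹ ^ 2 * c ^ 3 := by ring

/-- Young's inequality in place of Hölder's: both terms on the right are linear in cubic integrals
and can be integrated in time as they stand, with `κ` chosen at the end. No measurability of `G` is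
needed, because its terms always come second when an integral is split. -/
theorem lintegral_sq_mul_le {N : Vec → ℝ≥0∞} (hN : Measurable N) {S : Torus → ℝ≥0∞}
    (hS : AEMeasurable S) (G : Torus → Vec → ℝ≥0∞) {κ : ℝ≥0∞} (h0 : κ ≠ 0) (h1 : κ ≠ ⊤) :
    ∫⁻ x, S x ^ 2 * ∫⁻ y, N y * G x y ≤
      κ * (∫⁻ y, N y) * (∫⁻ x, S x ^ 3) + κ⁻¹ ^ 2 * ∫⁻ x, ∫⁻ y, N y * G x y ^ 3 := by
  have hκ : κ⁻¹ ^ 2 ≠ ⊤ := ENNReal.pow_ne_top (ENNReal.inv_ne_top.2 h0)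
  calc ∫⁻ x, S x ^ 2 * ∫⁻ y, N y * G x y
      ≤ ∫⁻ x, ((κ * ∫⁻ y, N y) * S x ^ 3 + κ⁻¹ ^ 2 * ∫⁻ y, N y * G x y ^ 3) := by
        refine lintegral_mono fun x => (lintegral_const_mul_le _ _).trans ?_
        calc ∫⁻ y, S x ^ 2 * (N y * G x y)
            ≤ ∫⁻ y, (N y * (κ * S x ^ 3) + κ⁻¹ ^ 2 * (N y * G x y ^ 3)) := by
              refine lintegral_mono fun y => ?_
              calc S x ^ 2 * (N y * G x y) = N y * (S x ^ 2 * G x y) := by ring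
                _ ≤ N y * (κ * S x ^ 3 + κ⁻¹ ^ 2 * G x y ^ 3) := by
                  gcongr; exact young_cubic _ _ _ h0 h1
                _ = _ := by ring
          _ = _ := by
              rw [lintegral_add_left (hN.mul_const _), lintegral_mul_const _ hN,
                lintegral_const_mul' _ _ hκ]
              ring
    _ = _ := by
        rw [lintegral_add_left' ((hS.pow_const 3).const_mul _),
          lintegral_const_mul'' _ (hS.pow_const 3), lintegral_const_mul' _ _ hκ]

/-- The kernel that controls the flux of a mollified field. -/
def fluxKernel (K : Vec → ℝ) (y : Vec) : ℝ≥0∞ := 6 * ‖K y‖ₑ + ∑ i, ‖dker i K y‖ₑ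

theorem measurable_fluxKernel {K : Vec → ℝ} (hK : IsKernel K) : Measurable (fluxKernel K) := by
  unfold fluxKernel
  have h1 := hK.smooth.continuous.measurable
  have h2 := fun i => (hK.dker i).smooth.continuous.measurable
  fun_prop

theorem IsKernel.lintegral_lt_top {K : Vec → ℝ} (hK : IsKernel K) : ∫⁻ y, ‖K y‖ₑ < ⊤ :=
  hK.integrable.2

theorem lintegral_fluxKernel_ne_top {K : Vec → ℝ} (hK : IsKernel K) :
    ∫⁻ y, fluxKernel K y ≠ ⊤ := by
  have h1 := hK.smooth.continuous.measurable
  have h2 := fun i => (hK.dker i).smooth.continuous.measurable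
  unfold fluxKernel
  rw [lintegral_add_left (by fun_prop), lintegral_const_mul _ (by fun_prop),
    lintegral_finsetSum _ (fun i _ => (h2 i).enorm)]
  exact ENNReal.add_ne_top.2 ⟨ENNReal.mul_ne_top (by simp) hK.lintegral_lt_top.ne,
    ENNReal.sum_ne_top.2 fun i _ => (hK.dker i).lintegral_lt_top.ne⟩

theorem enorm_flux_moll_le {K : Vec → ℝ} (hK : IsKernel K) {g : Torus → Vec}
    (hg : Integrable g) (a b : Vec) (x : Torus) :
    ‖flux (moll K g) a b x‖ₑ ≤
      (‖a‖ₑ + ‖b‖ₑ) ^ 2 * ∫⁻ y, fluxKernel K y * ‖g (x - toTorus y)‖ₑ := by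
  have h1 := hK.smooth.continuous.measurable
  have h2 := fun i => (hK.dker i).smooth.continuous.measurable
  have hgm : AEMeasurable (fun y : Vec => ‖g (x - toTorus y)‖ₑ) := by
    obtain ⟨z, rfl⟩ := surjective_toTorus x
    have h3 := (locallyIntegrable_lift hg).aestronglyMeasurable.comp_quasiMeasurePreserving
      (Measure.measurePreserving_sub_left volume z).quasiMeasurePreserving
    simpa [Function.comp_def, toTorus_sub] using h3.enorm
  have e : ∫⁻ y, fluxKernel K y * ‖g (x - toTorus y)‖ₑ =
      6 * (∫⁻ y, ‖K y‖ₑ * ‖g (x - toTorus y)‖ₑ) +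
        ∑ i, ∫⁻ y, ‖dker i K y‖ₑ * ‖g (x - toTorus y)‖ₑ := by
    simp_rw [fluxKernel, add_mul, Finset.sum_mul, mul_assoc]
    have h3 : AEMeasurable (fun y => ‖K y‖ₑ * ‖g (x - toTorus y)‖ₑ) :=
      h1.enorm.aemeasurable.mul hgm
    have h4 : ∀ i, AEMeasurable (fun y => ‖dker i K y‖ₑ * ‖g (x - toTorus y)‖ₑ) :=
      fun i => (h2 i).enorm.aemeasurable.mul hgm
    rw [lintegral_add_left' (h3.const_mul _), lintegral_const_mul'' _ h3,
      lintegral_finsetSum' _ fun i _ => h4 i]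
  rw [e, mul_add]
  refine (enorm_add_le _ _).trans (add_le_add ?_ ?_)
  · refine (enorm_det3_le _ _ _).trans ?_
    calc 6 * ((‖a‖ₑ + ‖b‖ₑ) ^ 2 * ‖moll K g x‖ₑ)
        ≤ 6 * ((‖a‖ₑ + ‖b‖ₑ) ^ 2 * ∫⁻ y, ‖K y‖ₑ * ‖g (x - toTorus y)‖ₑ) := by
          gcongr; exact enorm_moll_le K g x
      _ = _ := by ring
  · refine (enorm_gradContract_le _ _ _).trans ?_
    gcongr with i
    · exact le_add_self
    · rw [pderiv_moll hK hg]
      exact enorm_moll_le _ g x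

theorem aemeasurable_kernel_enorm {N : Vec → ℝ≥0∞} (hN : Measurable N) {g : Torus → Vec}
    (hg : AEStronglyMeasurable g volume) :
    AEMeasurable (Function.uncurry fun (x : Torus) (y : Vec) =>
      N y * ‖g (x - toTorus y)‖ₑ ^ 3) (volume.prod volume) := by
  have h := (hg.comp_quasiMeasurePreserving quasiMeasurePreserving_sub_toTorus).enorm
  exact (hN.comp measurable_snd).aemeasurable.mul (h.pow_const 3)

theorem lintegral_kernel_enorm {N : Vec → ℝ≥0∞} (hN : Measurable N) {g : Torus → Vec}
    (hg : AEStronglyMeasurable g volume) :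
    ∫⁻ x, ∫⁻ y, N y * ‖g (x - toTorus y)‖ₑ ^ 3 = (∫⁻ y, N y) * ∫⁻ x, ‖g x‖ₑ ^ 3 := by
  rw [lintegral_lintegral_swap (aemeasurable_kernel_enorm hN hg), ← lintegral_mul_const _ hN]
  refine lintegral_congr fun y => ?_
  have hg' : AEMeasurable (fun x : Torus => ‖g (x - toTorus y)‖ₑ ^ 3) :=
    (hg.comp_measurePreserving (measurePreserving_sub_toTorus y)).enorm.pow_const 3
  rw [lintegral_const_mul'' _ hg', lintegral_sub_right_eq_self (fun x => ‖g x‖ₑ ^ 3)]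

/-- Crude bound for the error fields `h(t) - h(τ)`. Its constant is not uniform in the scale of `K`,
which is harmless because the kernel stays fixed while `g` tends to zero in `L³`. -/
theorem enorm_integral_flux_moll_le {K : Vec → ℝ} (hK : IsKernel K) {g a b : Torus → Vec}
    (hg : Integrable g) (ha : AEStronglyMeasurable a volume) (hb : AEStronglyMeasurable b volume)
    {κ : ℝ≥0∞} (h0 : κ ≠ 0) (h1 : κ ≠ ⊤) :
    ‖∫ x, flux (moll K g) (a x) (b x) x‖ₑ ≤ (∫⁻ y, fluxKernel K y) *
      (κ * (∫⁻ x, (‖a x‖ₑ + ‖b x‖ₑ) ^ 3) + κ⁻¹ ^ 2 * ∫⁻ x, ‖g x‖ₑ ^ 3) := by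
  refine (enorm_integral_le_lintegral_enorm _).trans ?_
  refine (lintegral_mono fun x => enorm_flux_moll_le hK hg (a x) (b x) x).trans ?_
  refine (lintegral_sq_mul_le (measurable_fluxKernel hK) (S := fun x => ‖a x‖ₑ + ‖b x‖ₑ)
    (ha.enorm.add hb.enorm) _ h0 h1).trans ?_
  rw [lintegral_kernel_enorm (measurable_fluxKernel hK) hg.1]
  exact le_of_eq (by ring)

/-- The mean cubic increment of `f` at scale `ε`. -/
def cubicIncrement (ε : ℝ) (f : Torus → Vec) : ℝ≥0∞ :=
  ∫⁻ x, ⨍⁻ y, ‖f x - f (x - toTorus y)‖ₑ ^ 3 ∂(volume.restrict (Metric.ball (0 : Vec) ε))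

/-- Even kernels of integral one that live at scale `ε`. -/
structure IsMollifier (A : ℝ≥0∞) (ε : ℝ) (K : Vec → ℝ) : Prop extends IsKernel K where
  even : ∀ y, K (-y) = K y
  integral_eq_one : ∫ y, K y = 1
  bound : ∀ y, ‖K y‖ₑ ≤
    (Metric.ball (0 : Vec) ε).indicator (fun _ => A * (volume (Metric.ball (0 : Vec) ε))⁻¹) y
  bound_dker : ∀ i y, ‖dker i K y‖ₑ ≤ (Metric.ball (0 : Vec) ε).indicator
    (fun _ => A * ENNReal.ofReal ε⁻¹ * (volume (Metric.ball (0 : Vec) ε))⁻¹) y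

/-- The pointwise bound on `N` is a multiple of the uniform density on the ball, which is exactly
the average in `cubicIncrement`. -/
theorem lintegral_kernel_increment_le {N : Vec → ℝ≥0∞} {B : ℝ≥0∞} (hB : B ≠ ⊤) {ε : ℝ}
    (hε : 0 < ε) (hN : ∀ y, N y ≤ (Metric.ball (0 : Vec) ε).indicator
      (fun _ => B * (volume (Metric.ball (0 : Vec) ε))⁻¹) y) (f : Torus → Vec) :
    ∫⁻ x, ∫⁻ y, N y * ‖f x - f (x - toTorus y)‖ₑ ^ 3 ≤ B * cubicIncrement ε f := by
  have hv : (volume (Metric.ball (0 : Vec) ε))⁻¹ ≠ ⊤ :=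
    ENNReal.inv_ne_top.2 (Metric.measure_ball_pos volume _ hε).ne'
  rw [cubicIncrement, ← lintegral_const_mul' _ _ hB]
  refine lintegral_mono fun x => ?_
  rw [laverage_eq, Measure.restrict_apply_univ, ENNReal.div_eq_inv_mul, ← mul_assoc,
    ← lintegral_const_mul' _ _ (ENNReal.mul_ne_top hB hv),
    ← lintegral_indicator Metric.isOpen_ball.measurableSet]
  refine lintegral_mono fun y => (mul_le_mul_left (hN y) _).trans ?_
  by_cases hy : y ∈ Metric.ball (0 : Vec) ε
  · simp only [indicator_of_mem hy]; exact le_rfl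
  · simp only [indicator_of_notMem hy]; simp

theorem IsMollifier.lintegral_enorm_le {A : ℝ≥0∞} {ε : ℝ} {K : Vec → ℝ} (hε : 0 < ε)
    (hK : IsMollifier A ε K) : ∫⁻ y, ‖K y‖ₑ ≤ A := by
  refine (lintegral_mono hK.bound).trans ?_
  rw [lintegral_indicator Metric.isOpen_ball.measurableSet, setLIntegral_const, mul_assoc,
    ENNReal.inv_mul_cancel (Metric.measure_ball_pos volume _ hε).ne' measure_ball_lt_top.ne,
    mul_one]

/-- The central estimate. In the determinant `moll K f` may be replaced by `moll K f - f`, an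
average of increments since `K` has integral one, and Young's inequality applies. The gradient term
is bounded through the cubic identity, where `dker` brings the factor `ε⁻¹`. -/
theorem enorm_integral_flux_moll_self_le {A : ℝ≥0∞} (hA : A ≠ ⊤) {ε : ℝ} (hε : 0 < ε)
    {K : Vec → ℝ} (hK : IsMollifier A ε K) {a f : Torus → Vec} (ha : MemLp a 2 volume)
    (hf : MemLp f 3 volume) (hd : IsDivFree f) {κ : ℝ≥0∞} (h0 : κ ≠ 0) (h1 : κ ≠ ⊤) :
    ‖∫ x, flux (moll K f) (a x) (f x) x‖ₑ ≤
      6 * A * κ * (∫⁻ x, (‖a x‖ₑ + ‖f x‖ₑ) ^ 3) +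
      (6 * A * κ⁻¹ ^ 2 + 3 * A * ENNReal.ofReal ε⁻¹) * cubicIncrement ε f := by
  have hk : IsKernel K := hK.toIsKernel
  have hfi : Integrable f := hf.integrable (by norm_num)
  have hf2 : MemLp f 2 volume := hf.mono_exponent (by norm_num)
  have hs := isSmooth_moll hk hfi
  have e1 : ∫ x, flux (moll K f) (a x) (f x) x =
      (∫ x, det3 (moll K f x) (a x) (f x)) + ∫ x, gradContract (moll K f) (f x) (f x) x :=
    integral_add (integrable_det3 hs ha hf2) (integrable_gradContract hs hf2 hf2)
  have b1 : ‖∫ x, det3 (moll K f x) (a x) (f x)‖ₑ ≤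
      6 * A * κ * (∫⁻ x, (‖a x‖ₑ + ‖f x‖ₑ) ^ 3) + 6 * A * κ⁻¹ ^ 2 * cubicIncrement ε f := by
    refine (enorm_integral_le_lintegral_enorm _).trans ?_
    have p1 : ∀ x, ‖det3 (moll K f x) (a x) (f x)‖ₑ ≤
        6 * ((‖a x‖ₑ + ‖f x‖ₑ) ^ 2 * ∫⁻ y, ‖K y‖ₑ * ‖f x - f (x - toTorus y)‖ₑ) := by
      intro x
      have q1 : det3 (moll K f x) (a x) (f x) = det3 (moll K f x - f x) (a x) (f x) := by
        rw [det3_sub, det3_self, sub_zero]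
      have q2 : moll K f x - f x = ∫ y, K y • (f (x - toTorus y) - f x) := by
        simp_rw [smul_sub]
        rw [integral_sub (integrable_moll hk hfi x) (hk.integrable.smul_const _),
          integral_smul_const, hK.integral_eq_one, one_smul]
        rfl
      have q3 : ‖moll K f x - f x‖ₑ ≤ ∫⁻ y, ‖K y‖ₑ * ‖f x - f (x - toTorus y)‖ₑ := by
        rw [q2]
        refine (enorm_integral_le_lintegral_enorm _).trans (le_of_eq ?_)
        refine lintegral_congr fun y => ?_
        rw [enorm_smul, ← enorm_neg (f (x - toTorus y) - f x), neg_sub]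
      rw [q1]
      refine (enorm_det3_le _ _ _).trans ?_
      gcongr
    refine (lintegral_mono p1).trans ?_
    rw [lintegral_const_mul' _ _ (by simp)]
    calc _ ≤ 6 * (κ * (∫⁻ y, ‖K y‖ₑ) * (∫⁻ x, (‖a x‖ₑ + ‖f x‖ₑ) ^ 3) +
          κ⁻¹ ^ 2 * ∫⁻ x, ∫⁻ y, ‖K y‖ₑ * ‖f x - f (x - toTorus y)‖ₑ ^ 3) := by
          gcongr
          exact lintegral_sq_mul_le hk.smooth.continuous.measurable.enorm
            (ha.1.enorm.add hf.1.enorm) _ h0 h1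
      _ ≤ 6 * (κ * A * (∫⁻ x, (‖a x‖ₑ + ‖f x‖ₑ) ^ 3) +
          κ⁻¹ ^ 2 * (A * cubicIncrement ε f)) := by
          gcongr
          · exact hK.lintegral_enorm_le hε
          · exact lintegral_kernel_increment_le hA hε hK.bound f
      _ = _ := by ring
  have b2 : ‖∫ x, gradContract (moll K f) (f x) (f x) x‖ₑ ≤
      3 * A * ENNReal.ofReal ε⁻¹ * cubicIncrement ε f := by
    have q1 := integral_gradContract_moll hk hK.even hf hd
    -- The favourable factor `4` of the cubic identity is simply given up.
    have q2 : ∀ r : ℝ, ‖r‖ₑ ≤ ‖4 * r‖ₑ := fun r => by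
      rw [enorm_mul]
      have : (1 : ℝ≥0∞) ≤ ‖(4 : ℝ)‖ₑ := by
        rw [Real.enorm_eq_ofReal (by norm_num)]; norm_num
      simpa using mul_le_mul_left this ‖r‖ₑ
    refine (q2 _).trans ?_
    rw [q1, enorm_neg]
    refine (enorm_sum_le _ _).trans ?_
    have q3 : ∀ i, ‖∫ p : Torus × Vec, dker i K p.2 * ((f p.1 i - f (p.1 - toTorus p.2) i) *
        ‖f p.1 - f (p.1 - toTorus p.2)‖ ^ 2) ∂(volume.prod volume)‖ₑ ≤
        A * ENNReal.ofReal ε⁻¹ * cubicIncrement ε f := by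
      intro i
      refine (enorm_integral_le_lintegral_enorm _).trans ?_
      have hm : AEMeasurable (fun p : Torus × Vec => ‖dker i K p.2‖ₑ *
          ‖f p.1 - f (p.1 - toTorus p.2)‖ₑ ^ 3) (volume.prod volume) :=
        ((hk.dker i).smooth.continuous.measurable.comp measurable_snd).enorm.aemeasurable.mul
          ((hf.1.comp_fst.sub (hf.1.comp_quasiMeasurePreserving
            quasiMeasurePreserving_sub_toTorus)).enorm.pow_const 3)
      calc _ ≤ ∫⁻ p : Torus × Vec, ‖dker i K p.2‖ₑ *
            ‖f p.1 - f (p.1 - toTorus p.2)‖ₑ ^ 3 ∂(volume.prod volume) := by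
            refine lintegral_mono fun p => ?_
            rw [enorm_mul]
            gcongr
            have r1 : ‖(f p.1 i - f (p.1 - toTorus p.2) i) *
                ‖f p.1 - f (p.1 - toTorus p.2)‖ ^ 2‖ ≤ ‖f p.1 - f (p.1 - toTorus p.2)‖ ^ 3 := by
              rw [norm_mul, norm_pow, norm_norm, pow_succ' _ 2]
              exact mul_le_mul_of_nonneg_right (abs_apply_le (f p.1 - f (p.1 - toTorus p.2)) i)
                (by positivity)
            have r2 := ENNReal.ofReal_le_ofReal r1
            rwa [ofReal_norm, ENNReal.ofReal_pow (norm_nonneg _), ofReal_norm] at r2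
        _ = ∫⁻ x, ∫⁻ y, ‖dker i K y‖ₑ * ‖f x - f (x - toTorus y)‖ₑ ^ 3 :=
            lintegral_prod _ hm
        _ ≤ _ := lintegral_kernel_increment_le (ENNReal.mul_ne_top hA ENNReal.ofReal_ne_top) hε
            (hK.bound_dker i) f
    refine (Finset.sum_le_sum fun i _ => q3 i).trans (le_of_eq ?_)
    simp
    ring
  rw [e1]
  refine (enorm_add_le _ _).trans ((add_le_add b1 b2).trans (le_of_eq ?_))
  ring

/-! ### Existence of mollifiers -/

theorem volume_ball_inv {ε : ℝ} (hε : 0 < ε) :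
    ENNReal.ofReal (ε⁻¹ ^ 3) = volume (Metric.ball (0 : Vec) 1) *
      (volume (Metric.ball (0 : Vec) ε))⁻¹ := by
  have h := Measure.addHaar_ball (volume : Measure Vec) 0 hε.le
  rw [finrank_euclideanSpace_fin] at h
  have h0 : volume (Metric.ball (0 : Vec) 1) ≠ 0 :=
    (Metric.measure_ball_pos volume _ one_pos).ne'
  have h1 : volume (Metric.ball (0 : Vec) 1) ≠ ⊤ := measure_ball_lt_top.ne
  have h2 : ENNReal.ofReal (ε ^ 3) ≠ 0 := (ENNReal.ofReal_pos.2 (by positivity)).ne'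
  rw [h, ENNReal.mul_inv (Or.inl h2) (Or.inl ENNReal.ofReal_ne_top), mul_comm, mul_assoc,
    ENNReal.inv_mul_cancel h0 h1, mul_one, inv_pow, ENNReal.ofReal_inv_of_pos (by positivity)]

/-- Rescale one normalized bump as `ε⁻³ η(y / ε)`. Since `ε⁻³ = |B₁| / |B_ε|`, a common bound for
`η` and its derivatives, times `|B₁|`, serves as `A` at every scale. -/
theorem exists_isMollifier :
    ∃ A : ℝ≥0∞, A ≠ ⊤ ∧ ∀ ε : ℝ, 0 < ε → ∃ K, IsMollifier A ε K := by
  let β : ContDiffBump (0 : Vec) := ⟨1 / 2, 1, by norm_num, by norm_num⟩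
  set η : Vec → ℝ := β.normed volume with hη
  have hηK : IsKernel η := ⟨β.contDiff_normed, β.hasCompactSupport_normed⟩
  have hη0 : ∀ y ∉ Metric.ball (0 : Vec) 1, η y = 0 := fun y hy => by
    have := β.support_normed_eq (μ := volume)
    exact Function.notMem_support.1 (by rw [this]; exact hy)
  have hηd : ∀ i, ∀ y ∉ Metric.ball (0 : Vec) 1, dker i η y = 0 := by
    intro i y hy
    -- Points of the unit sphere are included here: `η` vanishes there and is nonnegative, so they
    -- are minima and the derivative is zero.
    have hmin : IsLocalMin η y := by
      refine Eventually.of_forall fun z => ?_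
      change η y ≤ η z
      rw [hη0 y hy]; exact β.nonneg_normed z
    simp [dker, hmin.fderiv_eq_zero]
  obtain ⟨C, hC⟩ : ∃ C : ℝ, ∀ y, ‖η y‖ ≤ C ∧ ∀ i, ‖dker i η y‖ ≤ C := by
    obtain ⟨C, hC⟩ := hηK.compact.exists_bound_of_continuous hηK.smooth.continuous
    choose D hD using fun i => (hηK.dker i).compact.exists_bound_of_continuous
      (hηK.dker i).smooth.continuous
    have hDn : ∀ i, 0 ≤ D i := fun i => (norm_nonneg _).trans (hD i 0)
    have hCn : 0 ≤ C := (norm_nonneg _).trans (hC 0)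
    refine ⟨C + ∑ i, D i, fun y => ⟨(hC y).trans ?_, fun i => (hD i y).trans ?_⟩⟩
    · exact le_add_of_nonneg_right (Finset.sum_nonneg fun i _ => hDn i)
    · exact (Finset.single_le_sum (fun i _ => hDn i) (Finset.mem_univ i)).trans
        (le_add_of_nonneg_left hCn)
  refine ⟨ENNReal.ofReal C * volume (Metric.ball (0 : Vec) 1),
    ENNReal.mul_ne_top ENNReal.ofReal_ne_top measure_ball_lt_top.ne, fun ε hε => ?_⟩
  set K : Vec → ℝ := fun y => ε⁻¹ ^ 3 * η (ε⁻¹ • y) with hKdef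
  have hd : ∀ i y, dker i K y = ε⁻¹ ^ 3 * ε⁻¹ * dker i η (ε⁻¹ • y) := by
    intro i y
    have h1 : HasFDerivAt (fun y : Vec => ε⁻¹ • y) (ε⁻¹ • ContinuousLinearMap.id ℝ Vec) y :=
      (hasFDerivAt_id y).const_smul ε⁻¹
    have h2 := ((hηK.smooth.differentiable (by simp) (ε⁻¹ • y)).hasFDerivAt.comp y h1).const_mul
      (ε⁻¹ ^ 3)
    have h3 : fderiv ℝ K y = _ := h2.fderiv
    simp [dker, h3, mul_assoc]
  have hball : ∀ y : Vec, y ∉ Metric.ball (0 : Vec) ε → ε⁻¹ • y ∉ Metric.ball (0 : Vec) 1 := by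
    intro y hy
    simp only [Metric.mem_ball, dist_zero_right, not_lt] at hy ⊢
    rw [norm_smul, Real.norm_of_nonneg (by positivity), inv_mul_eq_div, one_le_div hε]
    exact hy
  have hb : ∀ z : ℝ, ‖z‖ ≤ C → ‖ε⁻¹ ^ 3 * z‖ₑ ≤ ENNReal.ofReal C *
      volume (Metric.ball (0 : Vec) 1) * (volume (Metric.ball (0 : Vec) ε))⁻¹ := by
    intro z hz
    rw [mul_assoc, ← volume_ball_inv hε, enorm_mul, Real.enorm_eq_ofReal (by positivity), mul_comm,
      ← ofReal_norm z]
    gcongr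
  have hcpt : HasCompactSupport K := by
    refine HasCompactSupport.intro (isCompact_closedBall (0 : Vec) ε) fun y hy => ?_
    have := hη0 _ (hball y fun h => hy (Metric.ball_subset_closedBall h))
    simp [hKdef, this]
  have hsm : ContDiff ℝ ∞ K :=
    contDiff_const.mul (hηK.smooth.comp (contDiff_const_smul ε⁻¹))
  refine ⟨K, ⟨⟨hsm, hcpt⟩, fun y => ?_, ?_, fun y => ?_, fun i y => ?_⟩⟩
  · simp [hKdef, hη, β.normed_neg]
  · rw [integral_const_mul, Measure.integral_comp_inv_smul, finrank_euclideanSpace_fin,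
      β.integral_normed, abs_of_pos (by positivity), smul_eq_mul, mul_one, ← mul_pow,
      inv_mul_cancel₀ hε.ne', one_pow]
  · by_cases hy : y ∈ Metric.ball (0 : Vec) ε
    · rw [indicator_of_mem hy]
      exact hb _ (hC _).1
    · have : K y = 0 := by simp [hKdef, hη0 _ (hball y hy)]
      simp [this]
  · by_cases hy : y ∈ Metric.ball (0 : Vec) ε
    · rw [indicator_of_mem hy, hd, mul_right_comm, enorm_mul,
        Real.enorm_eq_ofReal (r := ε⁻¹) (by positivity), mul_right_comm (ENNReal.ofReal C * _)]
      gcongr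
      exact hb _ ((hC _).2 i)
    · have : dker i K y = 0 := by rw [hd, hηd i _ (hball y hy), mul_zero]
      simp [this]

/-! ### Weak derivatives in time -/

/-- The primitive of an integrable function is absolutely continuous with derivative `F` almost
everywhere, which is enough to integrate by parts. -/
theorem integral_deriv_mul_primitive {T : ℝ} {F χ : ℝ → ℝ}
    (hF : IntervalIntegrable F volume 0 T) (hχ : ContDiff ℝ ∞ χ) (h0 : χ 0 = 0) (h1 : χ T = 0) :
    ∫ t in 0..T, deriv χ t * ∫ s in 0..t, F s = -∫ t in 0..T, χ t * F t := by
  have hG := hF.absolutelyContinuousOnInterval_intervalIntegral (left_mem_uIcc)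
  have hA : AbsolutelyContinuousOnInterval χ 0 T :=
    (hχ.of_le (by simp)).contDiffOn.absolutelyContinuousOnInterval
  have h := hA.integral_mul_deriv_eq_deriv_mul hG
  simp only [h0, h1, zero_mul, sub_zero, zero_sub] at h
  rw [← neg_eq_iff_eq_neg, ← h]
  refine intervalIntegral.integral_congr_ae ?_
  filter_upwards [hF.ae_hasDerivAt_integral] with t ht htm
  rw [(ht (uIoc_subset_uIcc htm) 0 left_mem_uIcc).deriv]

/-- Du Bois-Reymond: a continuous function whose derivative vanishes weakly is constant. -/
theorem eqOn_const_of_integral_deriv_mul_eq_zero {T : ℝ} (hT : 0 < T) {M : ℝ → ℝ}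
    (hM : ContinuousOn M (Icc 0 T))
    (h : ∀ χ : ℝ → ℝ, ContDiff ℝ ∞ χ → (∃ a b, 0 < a ∧ b < T ∧ ∀ t ∉ Icc a b, χ t = 0) →
      ∫ t in 0..T, deriv χ t * M t = 0) :
    ∃ c, ∀ t ∈ Icc 0 T, M t = c := by
  let β : ContDiffBump (T / 2) := ⟨T / 8, T / 4, by positivity, by linarith⟩
  set ρ : ℝ → ℝ := β.normed volume with hρ
  have hρs : ContDiff ℝ ∞ ρ := β.contDiff_normed
  have hρ0 : ∀ t ∉ Icc (T / 4) (3 * T / 4), ρ t = 0 := fun t ht => by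
    refine Function.notMem_support.1 ?_
    rw [hρ, β.support_normed_eq, Metric.mem_ball, Real.dist_eq, abs_lt]
    intro hc
    have hr : β.rOut = T / 4 := rfl
    rw [hr] at hc
    exact ht ⟨by linarith [hc.1], by linarith [hc.2]⟩
  have hMi : IntervalIntegrable M volume 0 T := by
    refine ContinuousOn.intervalIntegrable ?_
    rwa [uIcc_of_le hT.le]
  set c := ∫ t in 0..T, ρ t * M t with hc
  refine ⟨c, fun t ht => ?_⟩
  have key : ∀ᵐ t, t ∈ Ioo 0 T → M t - c = 0 := by
    refine isOpen_Ioo.ae_eq_zero_of_integral_contDiff_smul_eq_zero ?_ ?_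
    · exact ((hM.sub continuousOn_const).mono Ioo_subset_Icc_self).locallyIntegrableOn
        measurableSet_Ioo
    intro ζ hζ hζc hζs
    obtain ⟨a, b, ha, hb, hab⟩ : ∃ a b, 0 < a ∧ b < T ∧ ∀ t ∉ Icc a b, ζ t = 0 := by
      rcases (tsupport ζ).eq_empty_or_nonempty with he | hne
      · refine ⟨T / 2, T / 2, by linarith, by linarith, fun t _ => ?_⟩
        have : ζ = 0 := tsupport_eq_empty_iff.1 he
        simp [this]
      · obtain ⟨a, ha, ha'⟩ := hζc.isCompact.exists_isLeast hne
        obtain ⟨b, hb, hb'⟩ := hζc.isCompact.exists_isGreatest hne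
        refine ⟨a, b, (hζs ha).1, (hζs hb).2, fun t ht => ?_⟩
        by_contra h0
        have := subset_tsupport ζ (Function.mem_support.2 h0)
        exact ht ⟨ha' this, hb' this⟩
    set I := ∫ t in 0..T, ζ t with hI
    -- Subtracting `I * ρ` makes the integral zero, so the primitive `χ` vanishes near both
    -- endpoints and is an admissible test function.
    have hg : ContDiff ℝ ∞ (fun t => ζ t - I * ρ t) := hζ.sub (contDiff_const.mul hρs)
    set χ : ℝ → ℝ := fun t => ∫ s in 0..t, (ζ s - I * ρ s) with hχ
    have hχd : ∀ t, HasDerivAt χ (ζ t - I * ρ t) t := fun t =>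
      hg.continuous.integral_hasStrictDerivAt 0 t |>.hasDerivAt
    have hχd' : deriv χ = fun t => ζ t - I * ρ t := funext fun t => (hχd t).deriv
    have hχs : ContDiff ℝ ∞ χ := contDiff_infty_iff_deriv.2
      ⟨fun t => (hχd t).differentiableAt, hχd' ▸ hg⟩
    have hρ1 : ∫ t in 0..T, ρ t = 1 := by
      rw [intervalIntegral.integral_of_le hT.le, setIntegral_eq_integral_of_forall_compl_eq_zero,
        β.integral_normed]
      intro t ht
      refine hρ0 t fun h => ht ⟨by linarith [h.1], by linarith [h.2]⟩
    have hg0 : ∀ t ∉ Icc (min a (T / 4)) (max b (3 * T / 4)), ζ t - I * ρ t = 0 := by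
      intro t ht
      rw [hab t fun h => ht ⟨(min_le_left _ _).trans h.1, h.2.trans (le_max_left _ _)⟩,
        hρ0 t fun h => ht ⟨(min_le_right _ _).trans h.1, h.2.trans (le_max_right _ _)⟩]
      simp
    have ha0 : 0 < min a (T / 4) := lt_min ha (by linarith)
    have hb0 : max b (3 * T / 4) < T := max_lt hb (by linarith)
    have hχT : χ T = 0 := by
      simp only [hχ]
      rw [intervalIntegral.integral_sub (hζ.continuous.intervalIntegrable _ _)
        ((hρs.continuous.intervalIntegrable _ _).const_mul _), intervalIntegral.integral_const_mul,
        hρ1, mul_one, sub_self]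
    have hχ0 : ∀ t ∉ Icc (min a (T / 4)) (max b (3 * T / 4)), χ t = 0 := by
      intro t ht
      by_cases h1 : t < min a (T / 4)
      · refine intervalIntegral.integral_zero_ae (Eventually.of_forall fun s hs => hg0 s ?_)
        intro h2
        have := (uIoc_subset_uIcc hs)
        rcases le_total 0 t with h3 | h3
        · rw [uIcc_of_le h3] at this; linarith [h2.1, this.2]
        · rw [uIcc_of_ge h3] at this; linarith [h2.1, this.2]
      · have h2 : max b (3 * T / 4) < t := by
          by_contra h3
          exact ht ⟨not_lt.1 h1, not_lt.1 h3⟩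
        have h4 : χ t = χ T + ∫ s in T..t, (ζ s - I * ρ s) :=
          (intervalIntegral.integral_add_adjacent_intervals (hg.continuous.intervalIntegrable _ _)
            (hg.continuous.intervalIntegrable _ _)).symm
        rw [h4, hχT, zero_add]
        refine intervalIntegral.integral_zero_ae (Eventually.of_forall fun s hs => hg0 s ?_)
        intro h5
        have h6 : min T t < s := hs.1
        have h7 : max b (3 * T / 4) < min T t := lt_min hb0 h2
        linarith [h5.2]
    have h1 := h χ hχs ⟨_, _, ha0, hb0, hχ0⟩
    rw [hχd'] at h1
    have hζM : IntervalIntegrable (fun t => ζ t * M t) volume 0 T :=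
      hMi.continuousOn_mul hζ.continuous.continuousOn
    have hρM : IntervalIntegrable (fun t => ρ t * M t) volume 0 T :=
      hMi.continuousOn_mul hρs.continuous.continuousOn
    have h2 : ∫ t in 0..T, ζ t • (M t - c) = 0 := by
      have e : ∀ t, ζ t • (M t - c) = ((ζ t - I * ρ t) * M t) + (I * (ρ t * M t) - ζ t * c) := by
        intro t; simp only [smul_eq_mul]; ring
      simp_rw [e]
      rw [intervalIntegral.integral_add, h1, intervalIntegral.integral_sub,
        intervalIntegral.integral_const_mul, intervalIntegral.integral_mul_const]
      · ring
      · exact hρM.const_mul _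
      · exact (hζ.continuous.intervalIntegrable _ _).mul_const _
      · exact hMi.continuousOn_mul hg.continuous.continuousOn
      · exact (hρM.const_mul _).sub ((hζ.continuous.intervalIntegrable _ _).mul_const _)
    rw [← h2, intervalIntegral.integral_of_le hT.le,
      setIntegral_eq_integral_of_forall_compl_eq_zero]
    intro t ht
    rw [hab t fun h => ht ⟨by linarith [h.1], by linarith [h.2]⟩, zero_smul]
  have h2 : M =ᵐ[volume.restrict (Icc 0 T)] fun _ => c := by
    rw [Measure.restrict_congr_set Ioo_ae_eq_Icc.symm]
    filter_upwards [ae_restrict_of_ae key, ae_restrict_mem measurableSet_Ioo] with t h1 h2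
    exact sub_eq_zero.1 (h1 h2)
  -- Continuity turns equality almost everywhere into equality at every time, endpoints included.
  exact Measure.eqOn_Icc_of_ae_eq volume hT.ne h2 hM continuousOn_const ht

/-- The difference of `m` and the primitive of `F` is continuous with vanishing weak derivative,
hence constant. -/
theorem sub_eq_setIntegral_of_weak_deriv {T : ℝ} (hT : 0 < T) {m F : ℝ → ℝ}
    (hm : ContinuousOn m (Icc 0 T)) (hF : IntegrableOn F (Ioo 0 T))
    (h : ∀ χ : ℝ → ℝ, ContDiff ℝ ∞ χ → (∃ a b, 0 < a ∧ b < T ∧ ∀ t ∉ Icc a b, χ t = 0) →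
      ∫ t in Ioo 0 T, (deriv χ t * m t + χ t * F t) = 0)
    {s t : ℝ} (hs : s ∈ Icc 0 T) (ht : t ∈ Icc 0 T) (hst : s ≤ t) :
    m t - m s = ∫ τ in Ioc s t, F τ := by
  have hFi : IntervalIntegrable F volume 0 T := by
    rwa [intervalIntegrable_iff_integrableOn_Ioo_of_le hT.le]
  have hG : ContinuousOn (fun t => ∫ s in 0..t, F s) (Icc 0 T) := by
    have := hFi.absolutelyContinuousOnInterval_intervalIntegral (left_mem_uIcc)
      |>.continuousOn
    rwa [uIcc_of_le hT.le] at this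
  have hmi : IntervalIntegrable m volume 0 T := by
    refine ContinuousOn.intervalIntegrable ?_
    rwa [uIcc_of_le hT.le]
  have hGi : IntervalIntegrable (fun t => ∫ s in 0..t, F s) volume 0 T := by
    refine ContinuousOn.intervalIntegrable ?_
    rwa [uIcc_of_le hT.le]
  obtain ⟨c, hc⟩ := eqOn_const_of_integral_deriv_mul_eq_zero hT
    (M := fun t => m t - ∫ s in 0..t, F s) (hm.sub hG) (by
      intro χ hχ hab
      have h1 := h χ hχ hab
      obtain ⟨a, b, ha, hb, h0⟩ := hab
      have hd : Continuous (deriv χ) := hχ.continuous_deriv (by simp)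
      rw [← integral_Ioc_eq_integral_Ioo, ← intervalIntegral.integral_of_le hT.le,
        intervalIntegral.integral_add (hmi.continuousOn_mul hd.continuousOn)
          (hFi.continuousOn_mul hχ.continuous.continuousOn)] at h1
      simp_rw [mul_sub]
      rw [intervalIntegral.integral_sub (hmi.continuousOn_mul hd.continuousOn)
        (hGi.continuousOn_mul hd.continuousOn), integral_deriv_mul_primitive hFi hχ
          (h0 0 fun h => by linarith [h.1]) (h0 T fun h => by linarith [h.2])]
      linarith)
  have h1 := hc s hs
  have h2 := hc t ht
  have h3 : IntervalIntegrable F volume 0 s := hFi.mono_set (by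
    rw [uIcc_of_le hs.1, uIcc_of_le hT.le]; exact Icc_subset_Icc le_rfl hs.2)
  have h4 : IntervalIntegrable F volume 0 t := hFi.mono_set (by
    rw [uIcc_of_le ht.1, uIcc_of_le hT.le]; exact Icc_subset_Icc le_rfl ht.2)
  rw [← intervalIntegral.integral_of_le hst, ← intervalIntegral.integral_interval_sub_left h4 h3]
  linarith

/-! ### Evolution of the magnetic field against time-independent test fields -/

theorem MemLpLq.memLp {T : ℝ} {u : ℝ → Torus → Vec} (hu : MemLpLq T 3 3 u) :
    MemLp (Function.uncurry u) 3 ((volume.restrict (Ioo 0 T)).prod volume) := by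
  refine ⟨hu.1, ?_⟩
  rw [eLpNorm_lt_top_iff_lintegral_rpow_enorm_lt_top (by norm_num) (by norm_num),
    lintegral_prod _ (hu.1.enorm.pow_const _)]
  have h := hu.2
  norm_num at h ⊢
  exact h

theorem isSolenoidalTestField_smul {T : ℝ} {χ : ℝ → ℝ} (hχ : ContDiff ℝ ∞ χ)
    (hc : ∃ a b, 0 < a ∧ b < T ∧ ∀ t ∉ Icc a b, χ t = 0) {ψ : Torus → Vec} (hψ : IsSmooth ψ)
    (hd : ∀ x, div ψ x = 0) : IsSolenoidalTestField T fun t x => χ t • ψ x where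
  smooth := by
    have h1 : ContDiff ℝ ∞ fun p : ℝ × Vec => χ p.1 := hχ.comp contDiff_fst
    have h2 : ContDiff ℝ ∞ fun p : ℝ × Vec => ψ (toTorus p.2) :=
      ContDiff.comp (g := fun y : Vec => ψ (toTorus y)) hψ contDiff_snd
    exact h1.smul h2
  compactSupport := by
    obtain ⟨a, b, ha, hb, h⟩ := hc
    exact ⟨a, b, ha, hb, fun t ht => by funext x; simp [h t ht]⟩
  divFree := by
    intro t x
    have h := hd x
    simp only [div, hψ.pderiv_const_smul, PiLp.smul_apply, smul_eq_mul] at h ⊢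
    rw [← Finset.mul_sum, h, mul_zero]

theorem gradContract_const_smul {ψ : Torus → Vec} (hψ : IsSmooth ψ) (c : ℝ) (a b : Vec)
    (x : Torus) : gradContract (fun x => c • ψ x) a b x = c * gradContract ψ a b x := by
  simp only [gradContract, hψ.pderiv_const_smul, PiLp.smul_apply, smul_eq_mul, Finset.mul_sum,
    mul_assoc]

theorem curl_const_smul {ψ : Torus → Vec} (hψ : IsSmooth ψ) (c : ℝ) :
    curl (fun x => c • ψ x) = fun x => c • curl ψ x := by
  funext x
  ext j
  fin_cases j <;> simp [curl, hψ.pderiv_const_smul, mul_sub]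

theorem continuous_flux {w : Torus → Vec} (hw : IsSmooth w) :
    Continuous fun p : Torus × Vec × Vec => flux w p.2.1 p.2.2 p.1 := by
  have h1 : Continuous fun p : Vec × Vec × Vec => det3 p.1 p.2.1 p.2.2 := by
    unfold det3; fun_prop
  have h2 : Continuous fun p : Torus × Vec × Vec => (w p.1, p.2.1, p.2.2) :=
    (hw.continuous.comp continuous_fst).prodMk continuous_snd
  have h3 : ∀ i, Continuous fun p : Torus × Vec × Vec => p.2.2 i := fun i =>
    (comp i).continuous.comp (continuous_snd.comp continuous_snd)
  refine (h1.comp h2).add (continuous_finsetSum _ fun i _ => continuous_finsetSum _ fun j _ => ?_)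
  exact ((((hw.pderiv i).apply j).continuous.comp continuous_fst).mul (h3 j)).mul (h3 i)

theorem exists_abs_flux_le {w : Torus → Vec} (hw : IsSmooth w) :
    ∃ C, ∀ x a b, |flux w a b x| ≤ C * (‖a‖ + ‖b‖) ^ 2 := by
  obtain ⟨C, hC⟩ := hw.exists_bound
  choose D hD using fun i => (hw.pderiv i).exists_bound
  refine ⟨6 * C + (∑ i, D i) * 3, fun x a b => (abs_add_le _ _).trans ?_⟩
  rw [add_mul]
  refine add_le_add ((abs_det3_le _ _ _).trans ?_) ((abs_gradContract_le _ _ _ _).trans ?_)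
  · have := hC x
    have h2 : (‖a‖ + ‖b‖) ^ 2 * ‖w x‖ ≤ (‖a‖ + ‖b‖) ^ 2 * C := by gcongr
    linarith
  · have h1 : ∑ i, ‖pderiv i w x‖ ≤ ∑ i, D i := Finset.sum_le_sum fun i _ => hD i x
    have h0 : 0 ≤ ∑ i, ‖pderiv i w x‖ := Finset.sum_nonneg fun i _ => norm_nonneg _
    have h2 : ‖b‖ * ‖b‖ ≤ (‖a‖ + ‖b‖) ^ 2 := by
      nlinarith [norm_nonneg a, norm_nonneg b, mul_nonneg (norm_nonneg a) (norm_nonneg b)]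
    calc _ ≤ (∑ i, D i) * (3 * (‖a‖ + ‖b‖) ^ 2) :=
          mul_le_mul h1 (by linarith) (by positivity) (h0.trans h1)
      _ = _ := by ring

theorem integrableOn_integral_flux {T : ℝ} {u h : ℝ → Torus → Vec} (hu : MemLpLq T 3 3 u)
    (hh : MemLpLq T 3 3 h) {w : Torus → Vec} (hw : IsSmooth w) :
    IntegrableOn (fun t => ∫ x, flux w (u t x) (h t x) x) (Ioo 0 T) := by
  have hu2 := hu.memLp.mono_exponent (p := 2) (by norm_num)
  have hh2 := hh.memLp.mono_exponent (p := 2) (by norm_num)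
  obtain ⟨C, hC⟩ := exists_abs_flux_le hw
  have hi : Integrable (fun p : ℝ × Torus => flux w (u p.1 p.2) (h p.1 p.2) p.2)
      ((volume.restrict (Ioo 0 T)).prod volume) := by
    refine (((hu2.norm.add hh2.norm).integrable_sq).const_mul C).mono'
      ((continuous_flux hw).comp_aestronglyMeasurable
        (measurable_snd.aestronglyMeasurable.prodMk (hu2.1.prodMk hh2.1)))
      (Eventually.of_forall fun p => hC _ _ _)
  exact hi.integral_prod_left

/-- Test the induction equation with the product of a scalar cut-off in time and `ψ`. Weak
continuity of `h` makes the identity hold at all times and not just almost all. -/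
theorem IsWeakSolution.integral_inner_sub {T : ℝ} (hT : 0 < T) {u h : ℝ → Torus → Vec}
    (hsol : IsWeakSolution T u h) (hu : MemLpLq T 3 3 u) (hh : MemLpLq T 3 3 h)
    {ψ : Torus → Vec} (hψ : IsSmooth ψ) (hd : ∀ x, div ψ x = 0) {s t : ℝ} (hs : s ∈ Icc 0 T)
    (ht : t ∈ Icc 0 T) (hst : s ≤ t) :
    (∫ x, inner ℝ (h t x) (ψ x)) - ∫ x, inner ℝ (h s x) (ψ x) =
      ∫ τ in Ioc s t, ∫ x, flux (curl ψ) (u τ x) (h τ x) x := by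
  refine sub_eq_setIntegral_of_weak_deriv hT (m := fun t => ∫ x, inner ℝ (h t x) (ψ x))
    (by exact hsol.weakCont_h.2 ψ (hψ.memLp 2)) (integrableOn_integral_flux hu hh hψ.curl) ?_ hs ht hst
  intro χ hχ hc
  have h1 := hsol.induction _ (isSolenoidalTestField_smul hχ hc hψ hd)
  refine Eq.trans (setIntegral_congr_fun measurableSet_Ioo fun τ hτ => ?_) h1
  have hτ' : τ ∈ Icc 0 T := Ioo_subset_Icc_self hτ
  have hu2 := hsol.weakCont_u.1 τ hτ'
  have hh2 := hsol.weakCont_h.1 τ hτ'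
  have hdχ : ∀ x, deriv (fun s => χ s • ψ x) τ = deriv χ τ • ψ x := fun x =>
    deriv_smul_const (hχ.differentiable (by simp) τ) (ψ x)
  simp only [hdχ, curl_const_smul hψ, gradContract_const_smul hψ, gradContract_const_smul hψ.curl]
  rw [← integral_const_mul, ← integral_const_mul, ← integral_add
    ((integrable_inner_of_memLp_two hh2 (hψ.memLp 2)).const_mul _)
    ((integrable_flux hψ.curl hu2 hh2).const_mul _)]
  refine integral_congr_ae (Eventually.of_forall fun x => ?_)
  simp only [flux, real_inner_smul_left, ← gradContract_sub_gradContract]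
  rw [real_inner_comm]
  ring

/-! ### Convergence of mollified pairings -/

/-- Continuity of translations in `L²`, obtained from the continuous dependence of
`Lp.compMeasurePreserving` on the map. -/
theorem continuous_integral_inner_translate {f g : Torus → Vec} (hf : MemLp f 2 volume)
    (hg : MemLp g 2 volume) :
    Continuous fun y : Vec => ∫ x, inner ℝ (f x) (g (x - toTorus y)) := by
  let τ : Vec → C(Torus, Torus) := fun y => ⟨fun x => x - toTorus y, by fun_prop⟩
  have hτ : Continuous τ := by
    refine ContinuousMap.continuous_of_continuous_uncurry _ ?_
    change Continuous fun p : Vec × Torus => p.2 - toTorus p.1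
    fun_prop
  have hm : ∀ y, MeasurePreserving (τ y) volume volume := measurePreserving_sub_toTorus
  have h1 : Continuous fun y => Lp.compMeasurePreserving (τ y) (hm y) hg.toLp :=
    continuous_const.compMeasurePreservingLp hτ hm (by norm_num)
  have h2 : Continuous fun y =>
      inner ℝ hf.toLp (Lp.compMeasurePreserving (τ y) (hm y) hg.toLp) :=
    continuous_const.inner h1
  refine h2.congr fun y => ?_
  rw [L2.inner_def]
  refine integral_congr_ae ?_
  filter_upwards [hf.coeFn_toLp, Lp.coeFn_compMeasurePreserving hg.toLp (hm y),
    (hm y).quasiMeasurePreserving.ae_eq_comp hg.coeFn_toLp] with x e1 e2 e3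
  rw [e1, e2, e3]
  rfl

theorem tendsto_integral_inner_moll {A : ℝ≥0∞} (hA : A ≠ ⊤) {K : ℝ → Vec → ℝ}
    (hK : ∀ ε, 0 < ε → IsMollifier A ε (K ε)) {f g : Torus → Vec} (hf : MemLp f 2 volume)
    (hg : MemLp g 2 volume) :
    Tendsto (fun ε => ∫ x, inner ℝ (f x) (moll (K ε) g x)) (𝓝[>] 0)
      (𝓝 (∫ x, inner ℝ (f x) (g x))) := by
  set c : Vec → ℝ := fun y => ∫ x, inner ℝ (f x) (g (x - toTorus y)) with hc
  have hcc : Continuous c := continuous_integral_inner_translate hf hg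
  have hc0 : c 0 = ∫ x, inner ℝ (f x) (g x) := by simp [hc, toTorus_zero]
  rw [← hc0, Metric.tendsto_nhds]
  intro r hr
  -- `A` bounds the `L¹` norm of the kernels. The added `1` avoids division by zero and leaves room
  -- for a strict inequality.
  set r' : ℝ := r / (A.toReal + 1) with hr'
  have hA0 : 0 < A.toReal + 1 := by positivity
  have hr0 : 0 < r' := by positivity
  obtain ⟨d, hd, hd'⟩ := Metric.continuous_iff.1 hcc 0 r' hr0
  filter_upwards [Ioo_mem_nhdsGT hd] with ε hε
  have hKε := hK ε hε.1
  have hk : IsKernel (K ε) := hKε.toIsKernel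
  have hI := integrable_kernel_inner hk.integrable hf hg
  have e1 : ∫ x, inner ℝ (f x) (moll (K ε) g x) = ∫ y, K ε y * c y := by
    rw [integral_inner_moll hk hf hg, integral_prod_symm _ hI]
    simp_rw [hc, ← integral_const_mul]
  have hKc : Integrable fun y => K ε y * c y :=
    (hk.smooth.continuous.mul hcc).integrable_of_hasCompactSupport hk.compact.mul_right
  have e2 : (∫ y, K ε y * c y) - c 0 = ∫ y, K ε y * (c y - c 0) := by
    simp_rw [mul_sub]
    rw [integral_sub hKc (hk.integrable.mul_const _), integral_mul_const, hKε.integral_eq_one,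
      one_mul]
  have e3 : ∫ y, ‖K ε y‖ ≤ A.toReal := by
    rw [integral_norm_eq_lintegral_enorm hk.integrable.1]
    exact ENNReal.toReal_mono hA (hKε.lintegral_enorm_le hε.1)
  rw [dist_eq_norm, e1, e2]
  calc ‖∫ y, K ε y * (c y - c 0)‖ ≤ ∫ y, ‖K ε y‖ * r' := by
        refine norm_integral_le_of_norm_le (hk.integrable.norm.mul_const _)
          (Eventually.of_forall fun y => ?_)
        rw [norm_mul]
        by_cases hy : y ∈ Metric.ball (0 : Vec) ε
        · have := hd' y ((Metric.mem_ball.1 hy).trans hε.2)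
          rw [Real.dist_eq] at this
          exact mul_le_mul_of_nonneg_left this.le (norm_nonneg _)
        · have h0 := hKε.bound y
          rw [indicator_of_notMem hy, nonpos_iff_eq_zero, enorm_eq_zero] at h0
          simp [h0]
    _ = (∫ y, ‖K ε y‖) * r' := integral_mul_const _ _
    _ ≤ A.toReal * r' := by gcongr
    _ < (A.toReal + 1) * r' := by gcongr; linarith
    _ = r := by rw [hr']; field_simp

/-! ### Conservation of helicity -/

/-- Chain finitely many steps of length at most `r / 2`. The bounds add up because the half-open
intervals are disjoint. -/
theorem enorm_sub_le_lintegral_of_local {X : ℝ → ℝ} {W : ℝ → ℝ≥0∞} {T r : ℝ} (hr : 0 < r)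
    (h : ∀ s ∈ Icc 0 T, ∀ t ∈ Icc 0 T, s ≤ t → t - s < r →
      ‖X t - X s‖ₑ ≤ ∫⁻ τ in Ioc s t, W τ) {t : ℝ} (ht : t ∈ Icc 0 T) :
    ‖X t - X 0‖ₑ ≤ ∫⁻ τ in Ioc 0 t, W τ := by
  have key : ∀ n : ℕ, ∀ t ∈ Icc 0 T, t ≤ n * (r / 2) → ‖X t - X 0‖ₑ ≤ ∫⁻ τ in Ioc 0 t, W τ := by
    intro n
    induction n with
    | zero =>
      intro t ht h0
      have : t = 0 := le_antisymm (by simpa using h0) ht.1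
      simp [this]
    | succ n ih =>
      intro t ht hn
      push_cast at hn
      set s := max 0 (t - r / 2) with hs
      have hs0 : 0 ≤ s := le_max_left _ _
      have hst : s ≤ t := max_le ht.1 (by linarith)
      have hsT : s ∈ Icc 0 T := ⟨hs0, hst.trans ht.2⟩
      have h1 := ih s hsT (max_le (by positivity) (by linarith))
      have h2 := h s hsT t ht hst (by linarith [le_max_right 0 (t - r / 2)])
      rw [← Ioc_union_Ioc_eq_Ioc hs0 hst, lintegral_union measurableSet_Ioc
        (Ioc_disjoint_Ioc_of_le le_rfl)]
      calc ‖X t - X 0‖ₑ = ‖(X s - X 0) + (X t - X s)‖ₑ := by congr 1; ring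
        _ ≤ _ := (enorm_add_le _ _).trans (add_le_add h1 h2)
  obtain ⟨n, hn⟩ := exists_nat_ge (t / (r / 2))
  exact key n t ht ((div_le_iff₀ (by positivity)).1 hn)

theorem lintegral_enorm_cube_eq (f : Torus → Vec) :
    ∫⁻ x, ‖f x‖ₑ ^ 3 = eLpNorm f 3 volume ^ 3 := by
  have h := eLpNorm_nnreal_pow_eq_lintegral (f := f) (μ := volume) (p := 3) (by norm_num)
  have e : ((3 : NNReal) : ℝ) = ((3 : ℕ) : ℝ) := by norm_num
  rw [e] at h
  simp only [ENNReal.rpow_natCast] at h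
  exact h.symm

/-- Heine-Cantor for the curve `t ↦ h t` in `Lp` over a compact interval. -/
theorem ContinuousInLp.uniform {T : ℝ} {h : ℝ → Torus → Vec} (hc : ContinuousInLp T 3 h)
    {δ : ℝ≥0∞} (hδ : 0 < δ) :
    ∃ r > 0, ∀ s ∈ Icc 0 T, ∀ t ∈ Icc 0 T, |s - t| < r →
      ∫⁻ x, ‖h s x - h t x‖ₑ ^ 3 ≤ δ ^ 3 := by
  have : Fact ((1 : ℝ≥0∞) ≤ 3) := ⟨by norm_num⟩
  let F : Icc (0 : ℝ) T → Lp Vec 3 (volume : Measure Torus) := fun t => (hc.1 t t.2).toLp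
  have hF : Continuous F := by
    refine continuous_iff_continuousAt.2 fun t₀ => ?_
    refine tendsto_iff_edist_tendsto_0.2 ?_
    have h1 := (hc.2 t₀ t₀.2).comp (tendsto_nhdsWithin_iff.2
      ⟨(continuous_subtype_val (p := fun x => x ∈ Icc (0 : ℝ) T)).continuousAt (x := t₀),
        Eventually.of_forall fun t => t.2⟩)
    refine h1.congr fun t => ?_
    exact (Lp.edist_toLp_toLp _ _ _ _).symm
  have hU := CompactSpace.uniformContinuous_of_continuous hF
  obtain ⟨r, hr, hr'⟩ := Metric.uniformity_basis_dist.uniformContinuous_iff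
    uniformity_basis_edist |>.1 hU δ hδ
  refine ⟨r, hr, fun s hs t ht hst => ?_⟩
  have h1 := hr' ⟨s, hs⟩ ⟨t, ht⟩ hst
  have h2 : edist (F ⟨s, hs⟩) (F ⟨t, ht⟩) = eLpNorm (h s - h t) 3 volume :=
    Lp.edist_toLp_toLp _ _ _ _
  rw [lintegral_enorm_cube_eq (fun x => h s x - h t x)]
  exact pow_le_pow_left' (h2 ▸ le_of_lt h1 : eLpNorm (h s - h t) 3 volume ≤ δ) 3

/-- Linearity of the flux in its field, applied to `f + g = 2k + (f - k) + (g - k)`. Here `f`, `g`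
are the end values of `h` and `k` is the value at the running time. -/
theorem flux_moll_add {K : Vec → ℝ} (hK : IsKernel K) {f g k : Torus → Vec}
    (hf : Integrable f) (hg : Integrable g) (hk : Integrable k) (a b : Vec) (x : Torus) :
    flux (fun x => moll K f x + moll K g x) a b x =
      2 * flux (moll K k) a b x + flux (moll K fun x => f x - k x) a b x +
        flux (moll K fun x => g x - k x) a b x := by
  have s1 := isSmooth_moll hK hf
  have s2 := isSmooth_moll hK hg
  simp only [flux, det3, gradContract, s1.pderiv_add s2, pderiv_moll hK hf, pderiv_moll hK hg,
    pderiv_moll hK hk, pderiv_moll hK (hf.sub' hk), pderiv_moll hK (hg.sub' hk),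
    moll_sub hK hf hk, moll_sub hK hg hk, moll_sub (hK.dker _) hf hk, moll_sub (hK.dker _) hg hk,
    PiLp.add_apply, PiLp.sub_apply, Fin.sum_univ_three]
  ring

/-! ### Increments of the mollified helicity and the limit of vanishing scale -/

section Conservation

variable {T : ℝ} {u h H : ℝ → Torus → Vec}

/-- The mollified helicity. -/
def mollHelicity (K : Vec → ℝ) (h H : ℝ → Torus → Vec) (t : ℝ) : ℝ :=
  ∫ x, inner ℝ (h t x) (moll K (H t) x)

/-- Polarization: for a symmetric form `B`, `B(h_t, h_t) - B(h_s, h_s) = B(h_t - h_s, h_t + h_s)`.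
The second slot becomes a test field frozen in time. -/
theorem mollHelicity_sub (hT : 0 < T) (hsol : IsWeakSolution T u h) (hu : MemLpLq T 3 3 u)
    (hh : MemLpLq T 3 3 h) (hH : ∀ t ∈ Icc 0 T, IsCurlInv (h t) (H t)) {K : Vec → ℝ}
    (hK : IsKernel K) (he : ∀ y, K (-y) = K y) {s t : ℝ} (hs : s ∈ Icc 0 T) (ht : t ∈ Icc 0 T)
    (hst : s ≤ t) :
    mollHelicity K h H t - mollHelicity K h H s =
      ∫ τ in Ioc s t, ∫ x, flux (fun x => moll K (h t) x + moll K (h s) x) (u τ x) (h τ x) x := by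
  have hL := hsol.weakCont_h.1
  have hHi : ∀ t ∈ Icc 0 T, Integrable (H t) := fun t ht => (hH t ht).memLp.integrable (by simp)
  have hsm : ∀ t ∈ Icc 0 T, IsSmooth (moll K (H t)) := fun t ht => isSmooth_moll hK (hHi t ht)
  have hcurl : ∀ t ∈ Icc 0 T, ∀ x, curl (moll K (H t)) x = moll K (h t) x := fun t ht x =>
    curl_moll hK he (hH t ht).memLp (hL t ht) (hH t ht).curl_eq x
  have hsum := (hsm t ht).add (hsm s hs)
  have hdiv : ∀ x, div (fun x => moll K (H t) x + moll K (H s) x) x = 0 := by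
    intro x
    have d1 := div_moll hK he (hH t ht).memLp (hH t ht).divFree x
    have d2 := div_moll hK he (hH s hs).memLp (hH s hs).divFree x
    simp only [div, (hsm t ht).pderiv_add (hsm s hs), PiLp.add_apply] at d1 d2 ⊢
    rw [Finset.sum_add_distrib, d1, d2, add_zero]
  have hc : curl (fun x => moll K (H t) x + moll K (H s) x) =
      fun x => moll K (h t) x + moll K (h s) x := by
    funext x
    rw [← hcurl t ht, ← hcurl s hs]
    ext j
    fin_cases j <;> simp [curl, (hsm t ht).pderiv_add (hsm s hs)] <;> ring
  have h1 := hsol.integral_inner_sub hT hu hh hsum hdiv hs ht hst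
  rw [hc] at h1
  rw [← h1]
  have hI : ∀ a ∈ Icc 0 T, ∀ b ∈ Icc 0 T,
      Integrable fun x => inner ℝ (h a x) (moll K (H b) x) := fun a ha b hb =>
    integrable_inner_of_memLp_two (hL a ha) ((hsm b hb).memLp 2)
  simp_rw [inner_add_right]
  rw [integral_add (hI t ht t ht) (hI t ht s hs), integral_add (hI s hs t ht) (hI s hs s hs)]
  -- Symmetry of the form: the curl moves from `H t` to the mollified `H s`, then the even kernel
  -- moves back.
  have hsymm : ∫ x, inner ℝ (h t x) (moll K (H s) x) = ∫ x, inner ℝ (h s x) (moll K (H t) x) := by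
    rw [← (hH t ht).curl_eq _ (hsm s hs)]
    simp_rw [hcurl s hs]
    rw [integral_inner_moll_comm hK (hH t ht).memLp (hL s hs) (c := 1)
      (fun y => by rw [he, one_mul]), one_mul]
    exact integral_congr_ae (Eventually.of_forall fun x => real_inner_comm _ _)
  rw [hsymm]
  simp only [mollHelicity]
  ring

/-- The cubic density that controls the flux. -/
def cubicDensity (u h : ℝ → Torus → Vec) (τ : ℝ) : ℝ≥0∞ := ∫⁻ x, (‖u τ x‖ₑ + ‖h τ x‖ₑ) ^ 3

theorem aemeasurable_cubicDensity (hu : MemLpLq T 3 3 u) (hh : MemLpLq T 3 3 h) :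
    AEMeasurable (cubicDensity u h) (volume.restrict (Ioo 0 T)) :=
  ((hu.1.enorm.add hh.1.enorm).pow_const 3).lintegral_prod_right'

theorem lintegral_cubicDensity_ne_top (hu : MemLpLq T 3 3 u) (hh : MemLpLq T 3 3 h) :
    ∫⁻ τ in Ioo 0 T, cubicDensity u h τ ≠ ⊤ := by
  have hm : AEMeasurable (fun p : ℝ × Torus => (‖u p.1 p.2‖ₑ + ‖h p.1 p.2‖ₑ) ^ 3)
    ((volume.restrict (Ioo 0 T)).prod volume) := (hu.1.enorm.add hh.1.enorm).pow_const 3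
  have h1 : ∫⁻ τ in Ioo 0 T, cubicDensity u h τ =
      ∫⁻ p : ℝ × Torus, (‖u p.1 p.2‖ₑ + ‖h p.1 p.2‖ₑ) ^ 3
        ∂((volume.restrict (Ioo 0 T)).prod volume) := (lintegral_prod _ hm).symm
  have h2 := (hu.memLp.norm.add hh.memLp.norm).2
  rw [eLpNorm_lt_top_iff_lintegral_rpow_enorm_lt_top (by norm_num) (by norm_num)] at h2
  rw [h1]
  refine ne_of_lt (lt_of_le_of_lt (lintegral_mono fun p => ?_) h2)
  have e : (3 : ℝ≥0∞).toReal = ((3 : ℕ) : ℝ) := by norm_num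
  rw [e, ENNReal.rpow_natCast]
  refine pow_le_pow_left' (le_of_eq ?_) 3
  simp only [Pi.add_apply, Function.uncurry]
  rw [Real.enorm_eq_ofReal (by positivity), ENNReal.ofReal_add (norm_nonneg _) (norm_nonneg _),
    ofReal_norm, ofReal_norm]

/-- The order of limits matters: the freezing error carries the kernel-dependent constant `N`, so
`δ` is sent to zero while `K` is fixed. The resulting bound depends on the kernel only through `A`
and `ε`. -/
theorem enorm_mollHelicity_sub_le (hT : 0 < T) (hsol : IsWeakSolution T u h)
    (hcont : ContinuousInLp T 3 h) (hu : MemLpLq T 3 3 u) (hh : MemLpLq T 3 3 h)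
    (hH : ∀ t ∈ Icc 0 T, IsCurlInv (h t) (H t)) {A : ℝ≥0∞} (hA : A ≠ ⊤) {ε : ℝ} (hε : 0 < ε)
    {K : Vec → ℝ} (hK : IsMollifier A ε K) {t : ℝ} (ht : t ∈ Icc 0 T) {κ : ℝ≥0∞} (h0 : κ ≠ 0)
    (h1 : κ ≠ ⊤) :
    ‖mollHelicity K h H t - mollHelicity K h H 0‖ₑ ≤
      2 * (6 * A * κ * (∫⁻ τ in Ioo 0 T, cubicDensity u h τ) +
        (6 * A * κ⁻¹ ^ 2 + 3 * A * ENNReal.ofReal ε⁻¹) *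
          ∫⁻ τ in Ioo 0 T, cubicIncrement ε (h τ)) := by
  have hk : IsKernel K := hK.toIsKernel
  set N := ∫⁻ y, fluxKernel K y with hN
  have hNt : N ≠ ⊤ := lintegral_fluxKernel_ne_top hk
  set S := ∫⁻ τ in Ioo 0 T, cubicDensity u h τ with hS
  have hSt : S ≠ ⊤ := lintegral_cubicDensity_ne_top hu hh
  set B := 6 * A * κ⁻¹ ^ 2 + 3 * A * ENNReal.ofReal ε⁻¹ with hB
  have hBt : B ≠ ⊤ := by
    refine ENNReal.add_ne_top.2 ⟨ENNReal.mul_ne_top (ENNReal.mul_ne_top (by simp) hA)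
      (ENNReal.pow_ne_top (ENNReal.inv_ne_top.2 h0)),
      ENNReal.mul_ne_top (ENNReal.mul_ne_top (by simp) hA) ENNReal.ofReal_ne_top⟩
  have hhi : ∀ t ∈ Icc 0 T, Integrable (h t) := fun t ht => (hcont.1 t ht).integrable (by norm_num)
  have key : ∀ δ : ℝ≥0∞, 0 < δ → δ ≠ ⊤ →
      ‖mollHelicity K h H t - mollHelicity K h H 0‖ₑ ≤
        δ * (2 * N * (S + ENNReal.ofReal T)) +
          2 * (6 * A * κ * S + B * ∫⁻ τ in Ioo 0 T, cubicIncrement ε (h τ)) := by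
    intro δ hδ hδt
    obtain ⟨r, hr, hr'⟩ := hcont.uniform hδ
    -- The increment term stands last: splitting the integral then requires measurability in time of
    -- the other terms only.
    set W : ℝ → ℝ≥0∞ := fun τ => (δ * (2 * N) * (cubicDensity u h τ + 1) +
      2 * (6 * A * κ) * cubicDensity u h τ) + 2 * B * cubicIncrement ε (h τ) with hW
    have hloc : ∀ s ∈ Icc 0 T, ∀ t ∈ Icc 0 T, s ≤ t → t - s < r →
        ‖mollHelicity K h H t - mollHelicity K h H s‖ₑ ≤ ∫⁻ τ in Ioc s t, W τ := by
      intro s hs t ht hst hsr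
      rw [mollHelicity_sub hT hsol hu hh hH hk hK.even hs ht hst]
      refine (enorm_integral_le_lintegral_enorm _).trans
        (setLIntegral_mono' measurableSet_Ioc fun τ hτ => ?_)
      have hτT : τ ∈ Icc 0 T := ⟨hs.1.trans hτ.1.le, hτ.2.trans ht.2⟩
      have hu2 := hsol.weakCont_u.1 τ hτT
      have hh2 := hsol.weakCont_h.1 τ hτT
      have hflux : ∀ {g : Torus → Vec}, Integrable g →
          Integrable fun x => flux (moll K g) (u τ x) (h τ x) x := fun hg =>
        integrable_flux (isSmooth_moll hk hg) hu2 hh2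
      have i1 := hflux (hhi τ hτT)
      have i2 := hflux ((hhi t ht).sub' (hhi τ hτT))
      have i3 := hflux ((hhi s hs).sub' (hhi τ hτT))
      simp_rw [flux_moll_add hk (hhi t ht) (hhi s hs) (hhi τ hτT)]
      have i12 : Integrable fun x => 2 * flux (moll K (h τ)) (u τ x) (h τ x) x +
        flux (moll K fun x => h t x - h τ x) (u τ x) (h τ x) x := (i1.const_mul 2).add i2
      rw [integral_add i12 i3, integral_add (i1.const_mul 2) i2, integral_const_mul]
      have herr : ∀ a ∈ Icc 0 T, |a - τ| < r →
          ‖∫ x, flux (moll K fun x => h a x - h τ x) (u τ x) (h τ x) x‖ₑ ≤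
            δ * N * (cubicDensity u h τ + 1) := by
        intro a ha har
        refine (enorm_integral_flux_moll_le hk ((hhi a ha).sub' (hhi τ hτT)) hu2.1 hh2.1 hδ.ne'
          hδt).trans ?_
        calc _ ≤ N * (δ * cubicDensity u h τ + δ⁻¹ ^ 2 * δ ^ 3) := by
              gcongr
              · exact le_rfl
              · exact hr' a ha τ hτT har
          _ = _ := by
              -- The Young parameter was taken equal to the `L³` modulus `δ`, so both error terms
              -- are of order `δ`.
              have : δ⁻¹ ^ 2 * δ ^ 3 = δ := by
                rw [pow_succ δ 2, ← mul_assoc, ← mul_pow, ENNReal.inv_mul_cancel hδ.ne' hδt,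
                  one_pow, one_mul]
              rw [this]; ring
      have hmain := enorm_integral_flux_moll_self_le hA hε hK hu2 (hcont.1 τ hτT)
        (hsol.divFree_h τ hτT) h0 h1
      have e2 : ‖(2 : ℝ)‖ₑ = 2 := by rw [Real.enorm_eq_ofReal (by norm_num)]; norm_num
      refine (enorm_add_le _ _).trans ((add_le_add (enorm_add_le _ _) le_rfl).trans ?_)
      rw [enorm_mul, e2]
      refine (add_le_add (add_le_add (mul_le_mul_right hmain 2)
        (herr t ht (abs_lt.2 ⟨by linarith [hτ.2], by linarith [hτ.1]⟩)))
        (herr s hs (abs_lt.2 ⟨by linarith [hτ.2], by linarith [hτ.1]⟩))).trans (le_of_eq ?_)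
      simp only [hW, cubicDensity]
      ring
    refine (enorm_sub_le_lintegral_of_local hr hloc ht).trans ?_
    have hsub : ∫⁻ τ in Ioc 0 t, W τ ≤ ∫⁻ τ in Ioo 0 T, W τ := by
      rw [Measure.restrict_congr_set (Ioo_ae_eq_Ioc (a := 0) (b := T))]
      exact lintegral_mono_set (Ioc_subset_Ioc_right ht.2)
    refine hsub.trans (le_of_eq ?_)
    have hcm := aemeasurable_cubicDensity hu hh
    have hm1 : AEMeasurable (fun τ => δ * (2 * N) * (cubicDensity u h τ + 1))
        (volume.restrict (Ioo 0 T)) := (hcm.add_const 1).const_mul _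
    have hm2 : AEMeasurable (fun τ => 2 * (6 * A * κ) * cubicDensity u h τ)
        (volume.restrict (Ioo 0 T)) := hcm.const_mul _
    simp only [hW]
    have hm12 : AEMeasurable (fun τ => δ * (2 * N) * (cubicDensity u h τ + 1) +
        2 * (6 * A * κ) * cubicDensity u h τ) (volume.restrict (Ioo 0 T)) := hm1.add hm2
    rw [lintegral_add_left' hm12, lintegral_add_left' hm1,
      lintegral_const_mul'' _ (hcm.add_const 1), lintegral_const_mul'' _ hcm,
      lintegral_const_mul' _ _ (ENNReal.mul_ne_top (by simp) hBt), lintegral_add_left' hcm,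
      lintegral_one, Measure.restrict_apply_univ, Real.volume_Ioo, sub_zero]
    ring
  set R := 2 * (6 * A * κ * S + B * ∫⁻ τ in Ioo 0 T, cubicIncrement ε (h τ)) with hR
  have hM : 2 * N * (S + ENNReal.ofReal T) ≠ ⊤ := ENNReal.mul_ne_top
    (ENNReal.mul_ne_top (by simp) hNt) (ENNReal.add_ne_top.2 ⟨hSt, ENNReal.ofReal_ne_top⟩)
  have hlim : Tendsto (fun δ : ℝ≥0∞ => δ * (2 * N * (S + ENNReal.ofReal T)) + R) (𝓝[>] 0)
      (𝓝 (0 * (2 * N * (S + ENNReal.ofReal T)) + R)) :=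
    (ENNReal.Tendsto.mul_const (tendsto_nhdsWithin_of_tendsto_nhds tendsto_id)
      (Or.inr hM)).add tendsto_const_nhds
  rw [zero_mul, zero_add] at hlim
  refine ge_of_tendsto hlim ?_
  filter_upwards [self_mem_nhdsWithin, nhdsWithin_le_nhds (Iio_mem_nhds ENNReal.zero_lt_top)]
    with δ hδ hδ'
  exact key δ hδ hδ'.ne

/-- The cube of the Besov-VMO condition: exponent `1/3` in `L³` becomes exactly the factor `ε⁻¹`
lost to the gradient of the kernel. -/
theorem tendsto_cubicIncrement (hh : MemBesovVMO T 3 (1 / 3) 3 h) :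
    Tendsto (fun ε : ℝ => ENNReal.ofReal ε⁻¹ * ∫⁻ τ in Ioo 0 T, cubicIncrement ε (h τ)) (𝓝[>] 0)
      (𝓝 0) := by
  have h1 := (ENNReal.continuous_pow 3).continuousAt.tendsto.comp hh.2
  simp only [ne_eq, OfNat.ofNat_ne_zero, not_false_eq_true, zero_pow] at h1
  refine h1.congr' ?_
  filter_upwards [self_mem_nhdsWithin] with ε hε
  have hε : 0 < ε := hε
  have e3 : (3 : ℝ) = ((3 : ℕ) : ℝ) := by norm_num
  have e : ∀ a : ℝ≥0∞, (a ^ (1 / (3 : ℝ))) ^ 3 = a := fun a => by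
    rw [← ENNReal.rpow_natCast, ← ENNReal.rpow_mul]; norm_num
  have e' : (ε ^ (-(1 / 3 : ℝ))) ^ 3 = ε⁻¹ := by
    rw [← Real.rpow_natCast, ← Real.rpow_mul hε.le, ← Real.rpow_neg_one]; norm_num
  simp only [Function.comp_apply]
  rw [mul_pow, e, ← ENNReal.ofReal_pow (by positivity), e', div_self (by norm_num)]
  simp only [ENNReal.rpow_one, cubicIncrement]
  rw [e3]
  simp only [ENNReal.rpow_natCast]

theorem helicity_conserved (hT : 0 < T) (hsol : IsWeakSolution T u h)
    (hcont : ContinuousInLp T 3 h) (hu : MemLpLq T 3 3 u) (hh : MemBesovVMO T 3 (1 / 3) 3 h)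
    (hH : ∀ t ∈ Icc 0 T, IsCurlInv (h t) (H t)) {t : ℝ} (ht : t ∈ Icc 0 T) :
    ∫ x, inner ℝ (H t x) (h t x) = ∫ x, inner ℝ (H 0 x) (h 0 x) := by
  obtain ⟨A, hA, hex⟩ := exists_isMollifier
  choose! K hK using hex
  have hlim : ∀ t ∈ Icc 0 T, Tendsto (fun ε => mollHelicity (K ε) h H t) (𝓝[>] 0)
      (𝓝 (∫ x, inner ℝ (H t x) (h t x))) := by
    intro t ht
    have h1 := tendsto_integral_inner_moll hA hK (hsol.weakCont_h.1 t ht) (hH t ht).memLp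
    have h2 : ∫ x, inner ℝ (H t x) (h t x) = ∫ x, inner ℝ (h t x) (H t x) :=
      integral_congr_ae (Eventually.of_forall fun x => real_inner_comm _ _)
    rw [h2]
    exact h1
  have h0 : (0 : ℝ) ∈ Icc 0 T := ⟨le_rfl, hT.le⟩
  have hl : Tendsto (fun ε => ‖mollHelicity (K ε) h H t - mollHelicity (K ε) h H 0‖ₑ) (𝓝[>] 0)
      (𝓝 ‖(∫ x, inner ℝ (H t x) (h t x)) - ∫ x, inner ℝ (H 0 x) (h 0 x)‖ₑ) :=
    ((hlim t ht).sub (hlim 0 h0)).enorm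
  set S := ∫⁻ τ in Ioo 0 T, cubicDensity u h τ with hS
  have hSt : S ≠ ⊤ := lintegral_cubicDensity_ne_top hu hh.1
  have hr : Tendsto (fun ε : ℝ => 2 * (6 * A * S * ENNReal.ofReal (√ε) + 9 * A *
      (ENNReal.ofReal ε⁻¹ * ∫⁻ τ in Ioo 0 T, cubicIncrement ε (h τ)))) (𝓝[>] 0)
      (𝓝 (2 * (6 * A * S * ENNReal.ofReal (√0) + 9 * A * 0))) := by
    refine ENNReal.Tendsto.const_mul (Tendsto.add (ENNReal.Tendsto.const_mul ?_ (Or.inr ?_))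
      (ENNReal.Tendsto.const_mul (tendsto_cubicIncrement hh) (Or.inr ?_))) (Or.inr (by simp))
    · exact (ENNReal.continuous_ofReal.comp Real.continuous_sqrt).continuousAt.tendsto.mono_left
        nhdsWithin_le_nhds
    · exact ENNReal.mul_ne_top (ENNReal.mul_ne_top (by simp) hA) hSt
    · exact ENNReal.mul_ne_top (by simp) hA
  simp only [Real.sqrt_zero, ENNReal.ofReal_zero, mul_zero, add_zero] at hr
  have hle : ‖(∫ x, inner ℝ (H t x) (h t x)) - ∫ x, inner ℝ (H 0 x) (h 0 x)‖ₑ ≤ 0 := by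
    refine le_of_tendsto_of_tendsto hl hr ?_
    filter_upwards [self_mem_nhdsWithin] with ε hε
    have hε : 0 < ε := hε
    have hs : 0 < √ε := Real.sqrt_pos.2 hε
    -- With `κ = √ε`, the factor `κ⁻²` is the same `ε⁻¹` as in the Hall term, and the remaining `κ`
    -- term still tends to zero.
    refine (enorm_mollHelicity_sub_le hT hsol hcont hu hh.1 hH hA hε (hK ε hε) ht
      (κ := ENNReal.ofReal (√ε)) (ENNReal.ofReal_pos.2 hs).ne' ENNReal.ofReal_ne_top).trans
      (le_of_eq ?_)
    have e : (ENNReal.ofReal (√ε))⁻¹ ^ 2 = ENNReal.ofReal ε⁻¹ := by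
      rw [← ENNReal.ofReal_inv_of_pos hs, ← ENNReal.ofReal_pow (by positivity), inv_pow,
        Real.sq_sqrt hε.le]
    rw [e]
    ring
  have := enorm_eq_zero.1 (le_antisymm hle zero_le)
  linarith

end Conservation

/-! ### Fourier series on the torus -/

section Fourier

open scoped ComplexConjugate
open UnitAddTorus Complex

/-- The Fourier coefficients with respect to the volume of the torus. -/
def coeff (f : Torus → ℂ) (n : Fin 3 → ℤ) : ℂ := ∫ x, mFourier (-n) x * f x

theorem volume_torus :
    (volume : Measure Torus) = Measure.pi fun _ : Fin 3 => AddCircle.haarAddCircle := by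
  rw [← volume_unitAddCircle]; rfl

/-- The measure is a variable so that `subst` can exchange the volume for the product of Haar
measures, on which the Fourier basis is defined. -/
theorem hasSum_conj_coeff_mul_aux {ν : Measure Torus}
    (hν : ν = Measure.pi fun _ : Fin 3 => AddCircle.haarAddCircle) {f g : Torus → ℂ}
    (hf : MemLp f 2 ν) (hg : MemLp g 2 ν) :
    HasSum (fun n => conj (∫ x, mFourier (-n) x * f x ∂ν) * ∫ x, mFourier (-n) x * g x ∂ν)
      (∫ x, conj (f x) * g x ∂ν) := by
  subst hν
  have h := hasSum_prod_mFourierCoeff (d := Fin 3) hf.toLp hg.toLp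
  have e : ∀ {f : Torus → ℂ} (hf : MemLp f 2 (Measure.pi fun _ : Fin 3 =>
      (AddCircle.haarAddCircle : Measure UnitAddCircle))) (n : Fin 3 → ℤ),
      mFourierCoeff (hf.toLp) n = ∫ x, mFourier (-n) x * f x
        ∂(Measure.pi fun _ : Fin 3 => AddCircle.haarAddCircle) := fun hf n =>
    integral_congr_ae (by filter_upwards [hf.coeFn_toLp] with x hx; simp [hx])
  simp_rw [e] at h
  convert! h using 1
  refine integral_congr_ae ?_
  filter_upwards [hf.coeFn_toLp, hg.coeFn_toLp] with x e1 e2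
  rw [e1, e2]

theorem hasSum_conj_coeff_mul {f g : Torus → ℂ} (hf : MemLp f 2 volume) (hg : MemLp g 2 volume) :
    HasSum (fun n => conj (coeff f n) * coeff g n) (∫ x, conj (f x) * g x) :=
  hasSum_conj_coeff_mul_aux volume_torus hf hg

theorem exists_memLp_coeff_aux {ν : Measure Torus}
    (hν : ν = Measure.pi fun _ : Fin 3 => AddCircle.haarAddCircle) {c : (Fin 3 → ℤ) → ℂ}
    (hc : Summable fun n => ‖c n‖ ^ 2) :
    ∃ f : Torus → ℂ, MemLp f 2 ν ∧ ∀ n, ∫ x, mFourier (-n) x * f x ∂ν = c n := by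
  subst hν
  have hm : Memℓp c 2 := memℓp_gen (by simpa using hc)
  let F := (mFourierBasis (d := Fin 3)).repr.symm ⟨c, hm⟩
  refine ⟨F, Lp.memLp F, fun n => ?_⟩
  have h := mFourierBasis_repr (d := Fin 3) F n
  simp only [F, LinearIsometryEquiv.apply_symm_apply] at h
  exact h.symm

theorem exists_memLp_coeff {c : (Fin 3 → ℤ) → ℂ} (hc : Summable fun n => ‖c n‖ ^ 2) :
    ∃ f : Torus → ℂ, MemLp f 2 volume ∧ ∀ n, coeff f n = c n :=
  exists_memLp_coeff_aux volume_torus hc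

theorem summable_sq_coeff {f : Torus → ℂ} (hf : MemLp f 2 volume) :
    Summable fun n => ‖coeff f n‖ ^ 2 := by
  have h := (hasSum_conj_coeff_mul hf hf).summable.norm
  simpa [sq] using h

theorem mFourier_toTorus (n : Fin 3 → ℤ) (y : Vec) :
    mFourier n (toTorus y) = exp (2 * Real.pi * I * ((∑ i, n i * y i : ℝ) : ℂ)) := by
  simp only [mFourier, ContinuousMap.coe_mk, toTorus, fourier_coe_apply]
  rw [← exp_sum]
  congr 1
  push_cast
  rw [Finset.mul_sum]
  refine Finset.sum_congr rfl fun i _ => ?_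
  ring

theorem isSmooth_mFourier (n : Fin 3 → ℤ) : IsSmooth fun x => mFourier n x := by
  unfold IsSmooth
  simp_rw [mFourier_toTorus]
  have h : ContDiff ℝ ∞ fun y : Vec => ∑ i, (n i : ℝ) * y i :=
    ContDiff.sum fun i _ => contDiff_const.mul (comp i).contDiff
  exact ContDiff.cexp (contDiff_const.mul (ofRealCLM.contDiff.comp h))

theorem pderiv_mFourier (n : Fin 3 → ℤ) (i : Fin 3) (x : Torus) :
    pderiv i (fun x => mFourier n x) x = 2 * Real.pi * I * n i * mFourier n x := by
  obtain ⟨y, rfl⟩ := surjective_toTorus x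
  have e : ∀ s : ℝ, mFourier n (toTorus y + Pi.single i (s : UnitAddCircle)) =
      exp ((2 * Real.pi * I * n i) * s) * mFourier n (toTorus y) := by
    intro s
    rw [← toTorus_smul_basisVec, ← toTorus_add, mFourier_toTorus, mFourier_toTorus, ← exp_add]
    congr 1
    have : ∑ j, n j * (y + s • basisVec i) j = (∑ j, n j * y j) + n i * s := by
      simp [mul_add, Finset.sum_add_distrib]
    rw [this]
    push_cast
    ring
  simp only [pderiv, e]
  have h1 : HasDerivAt (fun s : ℝ => (2 * Real.pi * I * n i) * (s : ℂ)) (2 * Real.pi * I * n i) 0 :=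
    by simpa using (ofRealCLM.hasDerivAt (x := (0 : ℝ))).const_mul (2 * Real.pi * I * n i)
  have h2 := (h1.cexp.mul_const (mFourier n (toTorus y))).deriv
  simpa using h2

theorem coeff_pderiv {φ : Torus → ℂ} (hφ : IsSmooth φ) (i : Fin 3) (n : Fin 3 → ℤ) :
    coeff (pderiv i φ) n = 2 * Real.pi * I * n i * coeff φ n := by
  have hm := isSmooth_mFourier (-n)
  have hs : IsSmooth fun x => mFourier (-n) x * φ x := ContDiff.mul hm hφ
  have hd : ∀ x, pderiv i (fun x => mFourier (-n) x * φ x) x =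
      -(2 * Real.pi * I * n i) * (mFourier (-n) x * φ x) + mFourier (-n) x * pderiv i φ x := by
    intro x
    have h := ((hm.hasDerivAt_zero i x).mul (hφ.hasDerivAt_zero i x)).deriv
    rw [pderiv_mFourier] at h
    simp only [QuotientAddGroup.mk_zero, Pi.single_zero, add_zero,
      Pi.neg_apply, Int.cast_neg] at h
    refine Eq.trans h ?_
    ring
  have h0 := hs.integral_pderiv i
  simp_rw [hd] at h0
  have hi : ∀ {f : Torus → ℂ}, IsSmooth f → Integrable f := fun hf =>
    (hf.memLp 1).integrable le_rfl
  have i1 := hi hs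
  have i2 : Integrable fun x => mFourier (-n) x * pderiv i φ x := hi (ContDiff.mul hm (hφ.pderiv i))
  rw [integral_add (i1.const_mul _) i2, integral_const_mul] at h0
  simp only [coeff]
  linear_combination h0

theorem IsSmooth.ofReal {f : Torus → ℝ} (hf : IsSmooth f) : IsSmooth fun x => (f x : ℂ) :=
  hf.comp_clm ofRealCLM

theorem coeff_ofReal_pderiv {φ : Torus → ℝ} (hφ : IsSmooth φ) (i : Fin 3) (n : Fin 3 → ℤ) :
    coeff (fun x => ((pderiv i φ x : ℝ) : ℂ)) n =
      2 * Real.pi * I * n i * coeff (fun x => (φ x : ℂ)) n := by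
  rw [← coeff_pderiv hφ.ofReal]
  congr 1
  funext x
  exact (hφ.pderiv_comp_clm ofRealCLM i x).symm

theorem coeff_sub {f g : Torus → ℂ} (hf : MemLp f 2 volume) (hg : MemLp g 2 volume)
    (n : Fin 3 → ℤ) : coeff (fun x => f x - g x) n = coeff f n - coeff g n := by
  have hm := (isSmooth_mFourier (-n)).memLp 2
  simp only [coeff, mul_sub]
  exact integral_sub (hm.integrable_mul hf) (hm.integrable_mul hg)

/-- Pairing of the real part of a complex field with a real function, by Parseval. -/
theorem hasSum_integral_re_mul {G : Torus → ℂ} (hG : MemLp G 2 volume) {φ : Torus → ℝ}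
    (hφ : MemLp φ 2 volume) :
    HasSum (fun n => (conj (coeff (fun x => (φ x : ℂ)) n) * coeff G n).re)
      (∫ x, (G x).re * φ x) := by
  have hφ' : MemLp (fun x => (φ x : ℂ)) 2 volume := hφ.ofReal
  have h := (hasSum_conj_coeff_mul hφ' hG).mapL reCLM
  have hi : Integrable fun x => conj (φ x : ℂ) * G x := hφ'.star.integrable_mul hG
  have e : reCLM (∫ x, conj (φ x : ℂ) * G x) = ∫ x, (G x).re * φ x := by
    rw [← reCLM.integral_comp_comm hi]
    refine integral_congr_ae (Eventually.of_forall fun x => ?_)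
    simp [mul_comm]
  rw [e] at h
  exact h

/-- Test functions are real, so the character is tested through its real and imaginary parts
separately. -/
theorem sum_coeff_eq_zero_of_isDivFree {w : Torus → Vec} (hw : MemLp w 2 volume)
    (hd : IsDivFree w) (n : Fin 3 → ℤ) :
    ∑ i, (n i : ℂ) * coeff (fun x => (w x i : ℂ)) n = 0 := by
  have hm := isSmooth_mFourier (-n)
  have hwi : ∀ i, MemLp (fun x => (w x i : ℂ)) 2 volume := fun i => (memLp_apply hw i).ofReal
  have hint : ∀ i, Integrable fun x => mFourier (-n) x * (w x i : ℂ) := fun i =>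
    (hm.memLp 2).integrable_mul (hwi i)
  set Z : ℂ := ∑ i, -(2 * Real.pi * I * n i) * coeff (fun x => (w x i : ℂ)) n with hZ
  have hZi : Integrable fun x => ∑ i, -(2 * Real.pi * I * n i) * (mFourier (-n) x * (w x i : ℂ)) :=
    integrable_finsetSum _ fun i _ => (hint i).const_mul _
  have hZ' : Z = ∫ x, ∑ i, -(2 * Real.pi * I * n i) * (mFourier (-n) x * (w x i : ℂ)) := by
    rw [integral_finsetSum _ fun i _ => (hint i).const_mul _]
    simp_rw [integral_const_mul]
    rfl
  have key : ∀ A : ℂ →L[ℝ] ℝ, (∀ (r : ℝ) (z : ℂ), A (z * r) = A z * r) → A Z = 0 := by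
    intro A hA
    have h := hd _ (hm.comp_clm A)
    rw [hZ', ← A.integral_comp_comm hZi, ← h]
    refine integral_congr_ae (Eventually.of_forall fun x => ?_)
    simp only [map_sum]
    refine Finset.sum_congr rfl fun i _ => ?_
    rw [hm.pderiv_comp_clm A, pderiv_mFourier, mul_comm (w x i), ← hA]
    congr 1
    simp only [Pi.neg_apply, Int.cast_neg]
    ring
  have hZ0 : Z = 0 := Complex.ext (key reCLM fun r z => by simp) (key imCLM fun r z => by simp)
  have h2 : Z = -(2 * Real.pi * I) * ∑ i, (n i : ℂ) * coeff (fun x => (w x i : ℂ)) n := by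
    rw [hZ, Finset.mul_sum]
    exact Finset.sum_congr rfl fun i _ => by ring
  rw [hZ0] at h2
  have h3 : -(2 * (Real.pi : ℂ) * I) ≠ 0 := by simp [Real.pi_ne_zero]
  exact (mul_eq_zero.1 h2.symm).resolve_left h3

/-! ### Existence of the vector potential -/

/-- The squared length of a frequency. -/
def freqSq (n : Fin 3 → ℤ) : ℂ := (n 0 : ℂ) ^ 2 + (n 1 : ℂ) ^ 2 + (n 2 : ℂ) ^ 2

theorem freqSq_ne_zero {n : Fin 3 → ℤ} (hn : n ≠ 0) : freqSq n ≠ 0 := by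
  have h : n 0 ^ 2 + n 1 ^ 2 + n 2 ^ 2 ≠ 0 := by
    intro h
    refine hn (funext fun i => ?_)
    have h0 : n 0 = 0 := by nlinarith [sq_nonneg (n 0), sq_nonneg (n 1), sq_nonneg (n 2)]
    have h1 : n 1 = 0 := by nlinarith [sq_nonneg (n 0), sq_nonneg (n 1), sq_nonneg (n 2)]
    have h2 : n 2 = 0 := by nlinarith [sq_nonneg (n 0), sq_nonneg (n 1), sq_nonneg (n 2)]
    fin_cases i <;> simpa
  unfold freqSq
  exact_mod_cast h

/-- For integers `|n i| ≤ (n i)²`. This makes `curl⁻¹` bounded on `L²`. At `n = 0` the quotient is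
`0` by the convention on division. -/
theorem norm_div_freqSq_le (n : Fin 3 → ℤ) (i : Fin 3) : ‖(n i : ℂ) / freqSq n‖ ≤ 1 := by
  rcases eq_or_ne n 0 with rfl | hn
  · simp
  have e : ‖freqSq n‖ = |((n 0 ^ 2 + n 1 ^ 2 + n 2 ^ 2 : ℤ) : ℝ)| := by
    rw [← Real.norm_eq_abs, ← Complex.norm_real]; congr 1; simp [freqSq]
  have hp : 0 < ‖freqSq n‖ := norm_pos_iff.2 (freqSq_ne_zero hn)
  rw [norm_div, div_le_one hp, e, Complex.norm_intCast, ← Int.cast_abs, ← Int.cast_abs, Int.cast_le]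
  have h1 : |n i| ≤ n i ^ 2 := by
    rw [← sq_abs]
    rcases (abs_nonneg (n i)).eq_or_lt with h | h
    · rw [← h]; simp
    · nlinarith
  refine h1.trans (le_trans ?_ (le_abs_self _))
  fin_cases i <;> simp <;> nlinarith [sq_nonneg (n 0), sq_nonneg (n 1), sq_nonneg (n 2)]

/-- The Fourier multiplier `(i / 2π) (n × a) / |n|²` of `curl⁻¹`, in coordinates. -/
def biotSavart (n : Fin 3 → ℤ) (a b : Fin 3) (f : Fin 3 → ℂ) : ℂ :=
  I / (2 * Real.pi) * ((n a : ℂ) / freqSq n * f b - (n b : ℂ) / freqSq n * f a)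

theorem norm_sq_biotSavart_le (n : Fin 3 → ℤ) (a b : Fin 3) (f : Fin 3 → ℂ) :
    ‖biotSavart n a b f‖ ^ 2 ≤ 2 * (‖f a‖ ^ 2 + ‖f b‖ ^ 2) := by
  have h0 : ‖I / (2 * (Real.pi : ℂ))‖ ≤ 1 := by
    rw [norm_div, norm_I, norm_mul, Complex.norm_real, Real.norm_of_nonneg Real.pi_pos.le]
    rw [div_le_one (by simp [Real.pi_pos])]
    simp only [Complex.norm_ofNat]
    linarith [Real.pi_gt_three]
  have h1 : ‖biotSavart n a b f‖ ≤ ‖f a‖ + ‖f b‖ := by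
    rw [biotSavart, norm_mul]
    have h2 : ∀ i j, ‖(n i : ℂ) / freqSq n * f j‖ ≤ ‖f j‖ := fun i j => by
      rw [norm_mul]
      exact mul_le_of_le_one_left (norm_nonneg _) (norm_div_freqSq_le n i)
    calc _ ≤ 1 * (‖f b‖ + ‖f a‖) := by
          gcongr
          exact (norm_sub_le _ _).trans (add_le_add (h2 a b) (h2 b a))
      _ = _ := by ring
  calc _ ≤ (‖f a‖ + ‖f b‖) ^ 2 := by gcongr
    _ ≤ _ := by nlinarith [sq_nonneg (‖f a‖ - ‖f b‖)]

theorem sum_mul_biotSavart (n : Fin 3 → ℤ) (f : Fin 3 → ℂ) :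
    (n 0 : ℂ) * biotSavart n 1 2 f + n 1 * biotSavart n 2 0 f + n 2 * biotSavart n 0 1 f = 0 := by
  simp only [biotSavart]; ring

/-- The weak curl equation at one frequency. It amounts to `n × (n × f) = n (n · f) - |n|² f`, whose
first term vanishes for `f` orthogonal to `n`. -/
theorem sum_conj_curl_mul_biotSavart {n : Fin 3 → ℤ} (hn : n ≠ 0) {f : Fin 3 → ℂ}
    (hf : ∑ i, (n i : ℂ) * f i = 0) (a : Fin 3 → ℂ) :
    conj (2 * Real.pi * I * n 1 * a 2 - 2 * Real.pi * I * n 2 * a 1) * biotSavart n 1 2 f +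
    conj (2 * Real.pi * I * n 2 * a 0 - 2 * Real.pi * I * n 0 * a 2) * biotSavart n 2 0 f +
    conj (2 * Real.pi * I * n 0 * a 1 - 2 * Real.pi * I * n 1 * a 0) * biotSavart n 0 1 f =
      conj (a 0) * f 0 + conj (a 1) * f 1 + conj (a 2) * f 2 := by
  have hq := freqSq_ne_zero hn
  have hπ : (Real.pi : ℂ) ≠ 0 := by simp [Real.pi_ne_zero]
  rw [Fin.sum_univ_three] at hf
  simp only [map_sub, map_mul, conj_ofReal, conj_I, map_ofNat, map_intCast, biotSavart]
  field_simp
  rw [I_sq]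
  unfold freqSq
  linear_combination (-((n 0 : ℂ) * conj (a 0) + n 1 * conj (a 1) + n 2 * conj (a 2))) * hf

/-- The vector potential of a divergence-free field of mean zero exists. -/
theorem exists_isCurlInv {w : Torus → Vec} (hw : MemLp w 2 volume) (hd : IsDivFree w)
    (hm : ∫ x, w x = 0) : ∃ V, IsCurlInv w V := by
  have hwC : ∀ i, MemLp (fun x => (w x i : ℂ)) 2 volume := fun i => (memLp_apply hw i).ofReal
  set f : (Fin 3 → ℤ) → Fin 3 → ℂ := fun n i => coeff (fun x => (w x i : ℂ)) n with hf
  have hfn : ∀ n, ∑ i, (n i : ℂ) * f n i = 0 := sum_coeff_eq_zero_of_isDivFree hw hd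
  have hf0 : ∀ i, f 0 i = 0 := by
    intro i
    have h1 : (∫ x, w x i) = 0 := by
      have := (comp i).integral_comp_comm (hw.integrable (by simp))
      rw [hm] at this
      simpa using this
    simp only [hf, coeff, neg_zero, mFourier_zero, ContinuousMap.one_apply, one_mul]
    exact integral_ofReal.trans (by rw [h1]; simp)
  have hex : ∀ a b, ∃ G : Torus → ℂ, MemLp G 2 volume ∧
      ∀ n, coeff G n = biotSavart n a b (f n) := fun a b =>
    exists_memLp_coeff ((((summable_sq_coeff (hwC a)).add
      (summable_sq_coeff (hwC b))).mul_left 2).of_nonneg_of_le (fun n => by positivity)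
      fun n => norm_sq_biotSavart_le n a b (f n))
  obtain ⟨G0, hG0, c0⟩ := hex 1 2
  obtain ⟨G1, hG1, c1⟩ := hex 2 0
  obtain ⟨G2, hG2, c2⟩ := hex 0 1
  have hre : ∀ {G : Torus → ℂ}, MemLp G 2 volume → MemLp (fun x => (G x).re) 2 volume :=
    fun hG => hG.re
  have hV : MemLp (fun x => (!₂[(G0 x).re, (G1 x).re, (G2 x).re] : Vec)) 2 volume := by
    refine MemLp.of_eval_piLp fun i => ?_
    fin_cases i
    · exact hre hG0
    · exact hre hG1
    · exact hre hG2
  -- Taking real parts spares a proof that the Fourier series are real: against real test functions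
  -- only real parts of the Parseval sums enter.
  refine ⟨fun x => !₂[(G0 x).re, (G1 x).re, (G2 x).re], hV, ?_, ?_, ?_⟩
  · have hz : ∀ {G : Torus → ℂ} {a b : Fin 3}, MemLp G 2 volume →
        (∀ n, coeff G n = biotSavart n a b (f n)) → ∫ x, (G x).re = 0 := by
      intro G a b hG hc
      have h1 := hc 0
      simp only [coeff, neg_zero, mFourier_zero, ContinuousMap.one_apply, one_mul, biotSavart,
        hf0, mul_zero, sub_zero] at h1
      have h2 := reCLM.integral_comp_comm (hG.integrable (by simp))
      rw [h1] at h2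
      simpa using h2
    have hVi := hV.integrable (by simp)
    ext i
    have h3 := (comp i).integral_comp_comm hVi
    refine Eq.trans h3.symm ?_
    fin_cases i
    · exact hz hG0 c0
    · exact hz hG1 c1
    · exact hz hG2 c2
  · intro ψ hψ
    have hp : ∀ {G : Torus → ℂ} (_ : MemLp G 2 volume) (i : Fin 3),
        HasSum (fun n => (conj (2 * Real.pi * I * n i * coeff (fun x => (ψ x : ℂ)) n) *
          coeff G n).re) (∫ x, (G x).re * pderiv i ψ x) := by
      intro G hG i
      have h1 := hasSum_integral_re_mul hG ((hψ.pderiv i).memLp 2)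
      simp_rw [coeff_ofReal_pderiv hψ] at h1
      exact h1
    have hi : ∀ {G : Torus → ℂ} (_ : MemLp G 2 volume) (i : Fin 3),
        Integrable fun x => (G x).re * pderiv i ψ x := fun hG i =>
      (hre hG).integrable_mul ((hψ.pderiv i).memLp 2)
    have hs := ((hp hG0 0).add (hp hG1 1)).add (hp hG2 2)
    have hz : ∀ n, (conj (2 * Real.pi * I * n 0 * coeff (fun x => (ψ x : ℂ)) n) * coeff G0 n).re +
        (conj (2 * Real.pi * I * n 1 * coeff (fun x => (ψ x : ℂ)) n) * coeff G1 n).re +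
        (conj (2 * Real.pi * I * n 2 * coeff (fun x => (ψ x : ℂ)) n) * coeff G2 n).re = 0 := by
      intro n
      rw [← add_re, ← add_re, c0, c1, c2]
      have h1 := sum_mul_biotSavart n (f n)
      simp only [map_mul, conj_ofReal, conj_I, map_ofNat, map_intCast]
      rw [← zero_re]
      congr 1
      linear_combination (-2 * Real.pi * I * conj (coeff (fun x => (ψ x : ℂ)) n)) * h1
    simp_rw [hz] at hs
    have h0 := hs.unique hasSum_zero
    have hi' : Integrable fun x => (G0 x).re * pderiv 0 ψ x + (G1 x).re * pderiv 1 ψ x :=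
      (hi hG0 0).add (hi hG1 1)
    rw [← h0, ← integral_add (hi hG0 0) (hi hG1 1), ← integral_add hi' (hi hG2 2)]
    refine integral_congr_ae (Eventually.of_forall fun x => ?_)
    simp [Fin.sum_univ_three]
  · intro φ hφ
    have hφi : ∀ i, MemLp (fun x => φ x i) 2 volume := fun i => (hφ.apply i).memLp 2
    set a : (Fin 3 → ℤ) → Fin 3 → ℂ := fun n i => coeff (fun x => (φ x i : ℂ)) n with ha
    have hca : ∀ i j k l n, coeff (fun x => ((pderiv i φ x j - pderiv k φ x l : ℝ) : ℂ)) n =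
        2 * Real.pi * I * n i * a n j - 2 * Real.pi * I * n k * a n l := by
      intro i j k l n
      have h1 : ∀ i j, MemLp (fun x => ((pderiv i φ x j : ℝ) : ℂ)) 2 volume := fun i j =>
        ((hφ.pderiv i).apply j).ofReal.memLp 2
      have h2 : ∀ i j, coeff (fun x => ((pderiv i φ x j : ℝ) : ℂ)) n =
          2 * Real.pi * I * n i * a n j := by
        intro i j
        have := coeff_ofReal_pderiv (hφ.apply j) i n
        simp_rw [hφ.pderiv_apply] at this
        exact this
      simp only [ofReal_sub]
      rw [coeff_sub (h1 i j) (h1 k l), h2, h2]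
    have hdm : ∀ i j k l, MemLp (fun x => pderiv i φ x j - pderiv k φ x l) 2 volume :=
      fun i j k l => (((hφ.pderiv i).apply j).sub ((hφ.pderiv k).apply l)).memLp 2
    have hp : ∀ {G : Torus → ℂ} (_ : MemLp G 2 volume) (i j k l : Fin 3),
        HasSum (fun n => (conj (2 * Real.pi * I * n i * a n j - 2 * Real.pi * I * n k * a n l) *
          coeff G n).re) (∫ x, (G x).re * (pderiv i φ x j - pderiv k φ x l)) := by
      intro G hG i j k l
      have h1 := hasSum_integral_re_mul hG (hdm i j k l)
      simp_rw [hca] at h1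
      exact h1
    have hi : ∀ {G : Torus → ℂ} (_ : MemLp G 2 volume) (i j k l : Fin 3),
        Integrable fun x => (G x).re * (pderiv i φ x j - pderiv k φ x l) := fun hG i j k l =>
      (hre hG).integrable_mul (hdm i j k l)
    have hs := ((hp hG0 1 2 2 1).add (hp hG1 2 0 0 2)).add (hp hG2 0 1 1 0)
    have hw' : ∀ i, HasSum (fun n => (conj (a n i) * f n i).re) (∫ x, w x i * φ x i) := fun i => by
      have h1 := hasSum_integral_re_mul (hwC i) (hφi i)
      simpa using h1
    have hr := ((hw' 0).add (hw' 1)).add (hw' 2)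
    have hwi : ∀ i, Integrable fun x => w x i * φ x i := fun i =>
      (memLp_apply hw i).integrable_mul (hφi i)
    have hz : ∀ n,
        (conj (2 * Real.pi * I * n 1 * a n 2 - 2 * Real.pi * I * n 2 * a n 1) * coeff G0 n).re +
        (conj (2 * Real.pi * I * n 2 * a n 0 - 2 * Real.pi * I * n 0 * a n 2) * coeff G1 n).re +
        (conj (2 * Real.pi * I * n 0 * a n 1 - 2 * Real.pi * I * n 1 * a n 0) * coeff G2 n).re =
        (conj (a n 0) * f n 0).re + (conj (a n 1) * f n 1).re + (conj (a n 2) * f n 2).re := by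
      intro n
      rw [← add_re, ← add_re, ← add_re, ← add_re, c0, c1, c2]
      congr 1
      -- At frequency zero the multiplier is zero, and the two sides agree only because `w` has mean
      -- zero.
      rcases eq_or_ne n 0 with rfl | hn
      · simp [hf0, biotSavart]
      · exact sum_conj_curl_mul_biotSavart hn (hfn n) (a n)
    simp_rw [hz] at hs
    have h0 := hs.unique hr
    have e1 : ∫ x, inner ℝ (!₂[(G0 x).re, (G1 x).re, (G2 x).re] : Vec) (curl φ x) =
        (∫ x, (G0 x).re * (pderiv 1 φ x 2 - pderiv 2 φ x 1)) +
        (∫ x, (G1 x).re * (pderiv 2 φ x 0 - pderiv 0 φ x 2)) +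
        ∫ x, (G2 x).re * (pderiv 0 φ x 1 - pderiv 1 φ x 0) := by
      have hi' : Integrable fun x => (G0 x).re * (pderiv 1 φ x 2 - pderiv 2 φ x 1) +
          (G1 x).re * (pderiv 2 φ x 0 - pderiv 0 φ x 2) :=
        (hi hG0 1 2 2 1).add (hi hG1 2 0 0 2)
      rw [← integral_add (hi hG0 1 2 2 1) (hi hG1 2 0 0 2), ← integral_add hi' (hi hG2 0 1 1 0)]
      refine integral_congr_ae (Eventually.of_forall fun x => ?_)
      simp only [inner_vec, curl]
      simp
    have e2 : ∫ x, inner ℝ (w x) (φ x) = (∫ x, w x 0 * φ x 0) + (∫ x, w x 1 * φ x 1) +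
        ∫ x, w x 2 * φ x 2 := by
      have hi' : Integrable fun x => w x 0 * φ x 0 + w x 1 * φ x 1 := (hwi 0).add (hwi 1)
      rw [← integral_add (hwi 0) (hwi 1), ← integral_add hi' (hwi 2)]
      refine integral_congr_ae (Eventually.of_forall fun x => ?_)
      simp only [inner_vec]
    rw [e1, e2, h0]

end Fourier

/-! ### Conservation of the mean and of the helicity -/

/-- The mean of the magnetic field is conserved. -/
theorem IsWeakSolution.integral_eq {T : ℝ} (hT : 0 < T) {u h : ℝ → Torus → Vec}
    (hsol : IsWeakSolution T u h) (hu : MemLpLq T 3 3 u) (hh : MemLpLq T 3 3 h) {t : ℝ}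
    (ht : t ∈ Icc 0 T) : ∫ x, h t x = ∫ x, h 0 x := by
  have h0 : (0 : ℝ) ∈ Icc 0 T := ⟨le_rfl, hT.le⟩
  have hi : ∀ t ∈ Icc 0 T, Integrable (h t) := fun t ht =>
    (hsol.weakCont_h.1 t ht).integrable (by simp)
  refine ext_inner_right ℝ fun c => ?_
  -- A constant test field has zero curl, so its flux vanishes and every component of the mean is
  -- conserved.
  have hcurl : curl (fun _ : Torus => c) = fun _ => 0 := by
    funext x; ext j
    fin_cases j <;> simp [curl, pderiv_const]
  have h1 := hsol.integral_inner_sub hT hu hh (isSmooth_const c)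
    (fun x => by simp [div, pderiv_const]) h0 ht ht.1
  have hz : ∀ a b x, flux (fun _ : Torus => (0 : Vec)) a b x = 0 := fun a b x => by
    simp [flux, det3, gradContract, pderiv_const]
  simp only [hcurl, hz, integral_zero] at h1
  have e : ∀ t ∈ Icc 0 T, inner ℝ (∫ x, h t x) c = ∫ x, inner ℝ (h t x) c := by
    intro t ht
    rw [real_inner_comm, ← integral_inner (hi t ht)]
    exact integral_congr_ae (Eventually.of_forall fun x => real_inner_comm _ _)
  rw [e t ht, e 0 h0]
  linarith

end HallMHD

end

theorem theorem1p4 (T : ℝ) (hT : 0 < T) (u h : ℝ → HallMHD.Torus → HallMHD.Vec)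
    (hsol : HallMHD.IsWeakSolution T u h)
    (hcont : HallMHD.ContinuousInLp T 3 h)
    (hmean : ∫ x, h 0 x = 0)
    (hu : HallMHD.MemLpLq T 3 3 u)
    (hh : HallMHD.MemBesovVMO T 3 (1 / 3) 3 h) :
    (∀ t ∈ Icc 0 T, ∃ H : HallMHD.Torus → HallMHD.Vec, HallMHD.IsCurlInv (h t) H) ∧
    ∀ H : ℝ → HallMHD.Torus → HallMHD.Vec,
      (∀ t ∈ Icc 0 T, HallMHD.IsCurlInv (h t) (H t)) →
      ∀ t ∈ Icc 0 T,
        Integrable (fun x => inner ℝ (H t x) (h t x)) ∧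
        ∫ x, inner ℝ (H t x) (h t x) = ∫ x, inner ℝ (H 0 x) (h 0 x) :=
  ⟨fun t ht => HallMHD.exists_isCurlInv (hsol.weakCont_h.1 t ht) (hsol.divFree_h t ht)
      ((hsol.integral_eq hT hu hh.1 ht).trans hmean),
    fun _ hH t ht => ⟨HallMHD.integrable_inner_of_memLp_two (hH t ht).memLp
      (hsol.weakCont_h.1 t ht), HallMHD.helicity_conserved hT hsol hcont hu hh hH ht⟩⟩
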